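/- Let $X, Y \in \mathbb{R}^3$ be linearly independent unit vectors and let $0 \le \kappa \le 1$. Put $\mathcal{C} = \{aX + bY : a, b \in \mathbb{R},\ |a| + |b| = 1\}$, and on the plane spanned by $X$ and $Y$ let $\mathrm{cost}(aX + bY) = |a| + \kappa |b|$. Identify $\mathbb{R}^3$ with the Lie algebra $so(3)$ of skew-symmetric $3 \times 3$ matrices by sending $v$ to the matrix of $w \mapsto v \times w$. For $g \in SO(3)$ call a pair $(t_0, U)$ admissible if $t_0 \ge 0$ and $U : [0, t_0] \to SO(3)$ is an absolutely continuous curve with $U(0) = I$, $U(t_0) = g$ and $U(t)^{-1} U'(t) \in \mathcal{C}$ for almost every $t \in [0, t_0]$. Then for every $g \in SO(3)$ there is an admissible pair $(t_0, U)$ such that $$\int_0^{t_0} \mathrm{cost}\bigl(U(t)^{-1} U'(t)\bigr)\, dt \;\le\; \int_0^{s_0} \mathrm{cost}\bigl(V(t)^{-1} V'(t)\bigr)\, dt$$ for every admissible pair $(s_0, V)$ for the same $g$ (the length of the time interval is not fixed). -/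

import Mathlib

open MeasureTheory

namespace AttitudeControl

/-- The matrix of `y ↦ v × y`; it identifies `ℝ³` with the Lie algebra `so(3)`. -/
def ad (v : EuclideanSpace ℝ (Fin 3)) : Matrix (Fin 3) (Fin 3) ℝ :=
  !![0, -(v 2), v 1; v 2, 0, -(v 0); -(v 1), v 0, 0]

/-- The inverse of `ad` on skew-symmetric matrices. -/
def unad (A : Matrix (Fin 3) (Fin 3) ℝ) : EuclideanSpace ℝ (Fin 3) :=
  !₂[A 2 1, A 0 2, A 1 0]

theorem ad_mulVec (v w : EuclideanSpace ℝ (Fin 3)) :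
    Matrix.mulVec (ad v) w.ofLp = crossProduct v.ofLp w.ofLp := by
  ext i
  fin_cases i <;>
    simp [ad, Matrix.mulVec, dotProduct, Fin.sum_univ_three, cross_apply] <;> ring

theorem unad_ad (v : EuclideanSpace ℝ (Fin 3)) : unad (ad v) = v := by
  ext i
  fin_cases i <;> simp [ad, unad]

theorem ad_unad {A : Matrix (Fin 3) (Fin 3) ℝ} (hA : A.transpose = -A) : ad (unad A) = A := by
  have h : ∀ i j, A j i = -A i j := fun i j => by
    simpa using congrFun (congrFun hA i) j
  ext i j
  fin_cases i <;> fin_cases j <;> simp [ad, unad] <;>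
    linarith [h 0 0, h 0 1, h 0 2, h 1 1, h 1 2, h 2 2]

/-- The control set `{aX + bY : |a| + |b| = 1}`. -/
def controlSet (X Y : EuclideanSpace ℝ (Fin 3)) : Set (EuclideanSpace ℝ (Fin 3)) :=
  {v | ∃ a b : ℝ, |a| + |b| = 1 ∧ v = a • X + b • Y}

open Classical in
/-- The cost function `cost (aX + bY) = |a| + κ |b|` on the plane spanned by the linearly
independent vectors `X`, `Y` (see `cost_apply`); it is given the value `0` off that plane. -/
noncomputable def cost (κ : ℝ) (X Y v : EuclideanSpace ℝ (Fin 3)) : ℝ :=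
  if h : ∃ p : ℝ × ℝ, v = p.1 • X + p.2 • Y then |h.choose.1| + κ * |h.choose.2| else 0

theorem cost_apply (κ : ℝ) {X Y : EuclideanSpace ℝ (Fin 3)} (hXY : LinearIndependent ℝ ![X, Y])
    (a b : ℝ) : cost κ X Y (a • X + b • Y) = |a| + κ * |b| := by
  have h : ∃ p : ℝ × ℝ, a • X + b • Y = p.1 • X + p.2 • Y := ⟨(a, b), rfl⟩
  obtain ⟨h1, h2⟩ := LinearIndependent.eq_of_pair hXY h.choose_spec
  rw [cost, dif_pos h, ← h1, ← h2]

/-- The derivative `U'(t)` of a matrix-valued curve, taken entry by entry. -/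
noncomputable def matDeriv (U : ℝ → Matrix (Fin 3) (Fin 3) ℝ) (t : ℝ) :
    Matrix (Fin 3) (Fin 3) ℝ :=
  Matrix.of fun i j => deriv (fun s => U s i j) t

/-- The velocity `U(t)⁻¹ U'(t)`, as a vector of `ℝ³ = so(3)`. -/
noncomputable def velocity (U : ℝ → Matrix (Fin 3) (Fin 3) ℝ) (t : ℝ) :
    EuclideanSpace ℝ (Fin 3) :=
  unad ((U t)⁻¹ * matDeriv U t)

/-- `U : [0, t₀] → SO(3)` is an absolutely continuous curve leading from `I` to `g` with
`U(t)⁻¹ U'(t)` in the control set for almost every `t`. Only the values of `U` on `[0, t₀]`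
matter. Absolute continuity and differentiability of a matrix-valued curve are those of its
entries; the last condition says `U'(t) = U(t) u(t)` with the control `u(t)` in the control set. -/
structure IsAdmissible (X Y : EuclideanSpace ℝ (Fin 3))
    (g : Matrix.specialOrthogonalGroup (Fin 3) ℝ) (t₀ : ℝ)
    (U : ℝ → Matrix (Fin 3) (Fin 3) ℝ) : Prop where
  nonneg : 0 ≤ t₀
  mem : ∀ t ∈ Set.Icc 0 t₀, U t ∈ Matrix.specialOrthogonalGroup (Fin 3) ℝ
  absolutelyContinuous : ∀ i j, AbsolutelyContinuousOnInterval (fun t => U t i j) 0 t₀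
  init : U 0 = 1
  final : U t₀ = g
  control : ∀ᵐ t ∂(volume.restrict (Set.Icc 0 t₀)),
    (∀ i j, HasDerivAt (fun s => U s i j) ((U t * ad (velocity U t)) i j) t) ∧
      velocity U t ∈ controlSet X Y

/-- The cost `∫₀^{t₀} cost (U(t)⁻¹ U'(t)) dt` of a curve. On admissible curves the integrand is
measurable and bounded, hence integrable. -/
noncomputable def totalCost (κ : ℝ) (X Y : EuclideanSpace ℝ (Fin 3)) (t₀ : ℝ)
    (U : ℝ → Matrix (Fin 3) (Fin 3) ℝ) : ℝ :=
  ∫ t in (0 : ℝ)..t₀, cost κ X Y (velocity U t)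

/-- `U` on `[0, t₀]` is admissible and its cost is the least one among the costs of all
admissible curves leading to `g`, on intervals `[0, s₀]` of any length `s₀ ≥ 0`. -/
def IsOptimal (κ : ℝ) (X Y : EuclideanSpace ℝ (Fin 3))
    (g : Matrix.specialOrthogonalGroup (Fin 3) ℝ) (t₀ : ℝ)
    (U : ℝ → Matrix (Fin 3) (Fin 3) ℝ) : Prop :=
  IsAdmissible X Y g t₀ U ∧
    ∀ (s₀ : ℝ) (V : ℝ → Matrix (Fin 3) (Fin 3) ℝ), IsAdmissible X Y g s₀ V →
      totalCost κ X Y t₀ U ≤ totalCost κ X Y s₀ V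

end AttitudeControl

/-! For `κ > 0` the direct method applies. Along an admissible curve `|a| + |b| = 1`, so the cost is
at least `κ` per unit time (`IsAdmissible.mul_le_totalCost`), and curves no more expensive than a
given one live on a bounded time interval. The obstruction is that the control set is not convex:
limits of controls only satisfy `|a| + |b| ≤ 1`. A curve is therefore recorded as `(U, α, β, c)`,
with integrated controls `α`, `β` and a function `c` whose increments dominate the cost. The
equation `U' = U (aX + bY)` is replaced by a second order expansion of increments. All conditions
then concern values at finitely many times, so they survive pointwise limits, and the set of such
quadruples is compact by Tychonoff (`isCompact_setOf_isRelaxed`). The value of `c` at the final time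
attains its minimum there.

The minimiser is turned back into an admissible curve by parametrising it by the length `∫ (|α'| +
|β'|)`. The speed becomes `1`, and the cost, being homogeneous of degree one in the velocity, does
not grow, since the duration is free (`exists_isAdmissible_of_isTrajectory`).

For `κ = 0` the cost no longer controls the duration, but the minimum is explicit. Let `S` be the
sine of the angle between `X` and `Y`. Turning about `Y` is free, and the angle between `Y` and
`U(t) Y` changes at rate at most `S |a|`, so the cost is at least `arccos ⟨Y, g Y⟩ / S`
(`IsAdmissible.arccos_le`). Euler angles in an orthonormal frame containing `Y` give a curve
attaining this bound (`exists_isAdmissible`). The same curve shows for `κ > 0` that there are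
competitors at all. -/

namespace AttitudeControl

open Set Filter Topology Matrix

/-! ### Entrywise bounds for rotations and controls. -/

/-- The skew-symmetric matrix belonging to the control `aX + bY`. -/
def gen (X Y : EuclideanSpace ℝ (Fin 3)) (a b : ℝ) : Matrix (Fin 3) (Fin 3) ℝ :=
  ad (a • X + b • Y)

theorem ad_add (v w : EuclideanSpace ℝ (Fin 3)) : ad (v + w) = ad v + ad w := by
  ext i j
  fin_cases i <;> fin_cases j <;> simp [ad] <;> ring

theorem ad_smul (c : ℝ) (v : EuclideanSpace ℝ (Fin 3)) : ad (c • v) = c • ad v := by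
  ext i j
  fin_cases i <;> fin_cases j <;> simp [ad]

theorem gen_eq (X Y : EuclideanSpace ℝ (Fin 3)) (a b : ℝ) :
    gen X Y a b = a • ad X + b • ad Y := by
  rw [gen, ad_add, ad_smul, ad_smul]

theorem mul_gen_apply (M : Matrix (Fin 3) (Fin 3) ℝ) (X Y : EuclideanSpace ℝ (Fin 3)) (a b : ℝ)
    (i j : Fin 3) : (M * gen X Y a b) i j = a * (M * ad X) i j + b * (M * ad Y) i j := by
  simp [gen_eq, Matrix.mul_add]

theorem abs_apply_le_one_of_mem {M : Matrix (Fin 3) (Fin 3) ℝ}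
    (hM : M ∈ Matrix.specialOrthogonalGroup (Fin 3) ℝ) (i j : Fin 3) : |M i j| ≤ 1 :=
  entry_norm_bound_of_unitary (𝕜 := ℝ) (mem_specialOrthogonalGroup_iff.1 hM).1 i j

theorem transpose_mul_self_of_mem {M : Matrix (Fin 3) (Fin 3) ℝ}
    (hM : M ∈ Matrix.specialOrthogonalGroup (Fin 3) ℝ) : Mᵀ * M = 1 := by
  exact (mem_orthogonalGroup_iff' _ _).1 (mem_specialOrthogonalGroup_iff.1 hM).1

theorem mul_transpose_self_of_mem {M : Matrix (Fin 3) (Fin 3) ℝ}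
    (hM : M ∈ Matrix.specialOrthogonalGroup (Fin 3) ℝ) : M * Mᵀ = 1 := by
  exact (mem_orthogonalGroup_iff _ _).1 (mem_specialOrthogonalGroup_iff.1 hM).1

theorem mem_specialOrthogonal_of {M : Matrix (Fin 3) (Fin 3) ℝ} (h : Mᵀ * M = 1)
    (hd : M.det = 1) : M ∈ Matrix.specialOrthogonalGroup (Fin 3) ℝ := by
  exact mem_specialOrthogonalGroup_iff.2 ⟨(mem_orthogonalGroup_iff' _ _).2 h, hd⟩

theorem inv_eq_transpose_of_mem {M : Matrix (Fin 3) (Fin 3) ℝ}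
    (hM : M ∈ Matrix.specialOrthogonalGroup (Fin 3) ℝ) : M⁻¹ = Mᵀ :=
  Matrix.inv_eq_left_inv (transpose_mul_self_of_mem hM)

theorem abs_ad_apply_le (v : EuclideanSpace ℝ (Fin 3)) (i j : Fin 3) : |ad v i j| ≤ ‖v‖ := by
  have h : ∀ k, |v k| ≤ ‖v‖ := fun k => by
    simpa using PiLp.norm_apply_le v k
  fin_cases i <;> fin_cases j <;> simp [ad, h]

theorem abs_mul_apply_le {M N : Matrix (Fin 3) (Fin 3) ℝ} {c d : ℝ} (hc : 0 ≤ c)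
    (hM : ∀ i j, |M i j| ≤ c) (hN : ∀ i j, |N i j| ≤ d) (i j : Fin 3) :
    |(M * N) i j| ≤ 3 * (c * d) := by
  rw [Matrix.mul_apply]
  refine (Finset.abs_sum_le_sum_abs _ _).trans ?_
  calc ∑ k, |M i k * N k j| ≤ ∑ _k : Fin 3, c * d := by
        refine Finset.sum_le_sum fun k _ => ?_
        rw [abs_mul]
        exact mul_le_mul (hM i k) (hN k j) (abs_nonneg _) hc
    _ = 3 * (c * d) := by simp

theorem abs_gen_apply_le {X Y : EuclideanSpace ℝ (Fin 3)} (hX : ‖X‖ = 1) (hY : ‖Y‖ = 1)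
    (a b : ℝ) (i j : Fin 3) : |gen X Y a b i j| ≤ |a| + |b| := by
  refine (abs_ad_apply_le _ i j).trans ((norm_add_le _ _).trans ?_)
  simp [norm_smul, hX, hY]

/-! ### Trajectories and their second order expansion. -/

/-- `U` solves `U' = U (aX + bY)` on `[0, T]`, in integrated form. -/
structure IsTrajectory (X Y : EuclideanSpace ℝ (Fin 3)) (T : ℝ)
    (U : ℝ → Matrix (Fin 3) (Fin 3) ℝ) (a b : ℝ → ℝ) : Prop where
  mem : ∀ t ∈ Icc 0 T, U t ∈ Matrix.specialOrthogonalGroup (Fin 3) ℝ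
  continuousOn : ∀ i j, ContinuousOn (fun t => U t i j) (Icc 0 T)
  integrable_left : IntervalIntegrable a volume 0 T
  integrable_right : IntervalIntegrable b volume 0 T
  sub_eq : ∀ s ∈ Icc 0 T, ∀ t ∈ Icc 0 T, ∀ i j,
    U t i j - U s i j = ∫ r in s..t, (U r * gen X Y (a r) (b r)) i j

theorem uIcc_subset_of_mem {T s t : ℝ} (hs : s ∈ Icc 0 T) (ht : t ∈ Icc 0 T) :
    uIcc s t ⊆ Icc 0 T := by
  rw [uIcc]; exact Icc_subset_Icc (le_inf hs.1 ht.1) (sup_le hs.2 ht.2)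

theorem intervalIntegrable_of_mem {T s t : ℝ} {f : ℝ → ℝ} (hf : IntervalIntegrable f volume 0 T)
    (hs : s ∈ Icc 0 T) (ht : t ∈ Icc 0 T) : IntervalIntegrable f volume s t :=
  hf.mono_set ((uIcc_subset_of_mem hs ht).trans Icc_subset_uIcc)

theorem intervalIntegrable_mul_gen {X Y : EuclideanSpace ℝ (Fin 3)} {s t : ℝ}
    {U : ℝ → Matrix (Fin 3) (Fin 3) ℝ} {a b : ℝ → ℝ}
    (hU : ∀ i j, ContinuousOn (fun r => U r i j) (uIcc s t)) (ha : IntervalIntegrable a volume s t)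
    (hb : IntervalIntegrable b volume s t) (i j : Fin 3) :
    IntervalIntegrable (fun r => (U r * gen X Y (a r) (b r)) i j) volume s t := by
  have hc : ∀ Z : EuclideanSpace ℝ (Fin 3),
      ContinuousOn (fun r => (U r * ad Z) i j) (uIcc s t) := fun Z => by
    simp only [Matrix.mul_apply]
    exact continuousOn_finsetSum _ fun k _ => (hU i k).mul continuousOn_const
  simp only [mul_gen_apply]
  exact (ha.mul_continuousOn (hc X)).add (hb.mul_continuousOn (hc Y))

namespace IsTrajectory

variable {X Y : EuclideanSpace ℝ (Fin 3)} {T : ℝ} {U : ℝ → Matrix (Fin 3) (Fin 3) ℝ} {a b : ℝ → ℝ}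

theorem integrable_speed (h : IsTrajectory X Y T U a b) {s t : ℝ} (hs : s ∈ Icc 0 T)
    (ht : t ∈ Icc 0 T) : IntervalIntegrable (fun r => |a r| + |b r|) volume s t :=
  (intervalIntegrable_of_mem h.integrable_left hs ht).abs.add
    (intervalIntegrable_of_mem h.integrable_right hs ht).abs

theorem integrable_mul_gen (h : IsTrajectory X Y T U a b) {s t : ℝ} (hs : s ∈ Icc 0 T)
    (ht : t ∈ Icc 0 T) (i j : Fin 3) :
    IntervalIntegrable (fun r => (U r * gen X Y (a r) (b r)) i j) volume s t :=
  intervalIntegrable_mul_gen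
    (fun i j => (h.continuousOn i j).mono (uIcc_subset_of_mem hs ht))
    (intervalIntegrable_of_mem h.integrable_left hs ht)
    (intervalIntegrable_of_mem h.integrable_right hs ht) i j

theorem abs_sub_le (h : IsTrajectory X Y T U a b) (hX : ‖X‖ = 1) (hY : ‖Y‖ = 1) {s t : ℝ}
    (hs : s ∈ Icc 0 T) (ht : t ∈ Icc 0 T) (i j : Fin 3) :
    |U t i j - U s i j| ≤ 3 * |∫ r in s..t, (|a r| + |b r|)| := by
  rw [h.sub_eq s hs t ht i j]
  have := intervalIntegral.norm_integral_le_abs_of_norm_le (μ := volume) (a := s) (b := t)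
    (f := fun r => (U r * gen X Y (a r) (b r)) i j) (g := fun r => 3 * (|a r| + |b r|)) ?_
    ((h.integrable_speed hs ht).const_mul 3)
  · rwa [intervalIntegral.integral_const_mul, abs_mul, abs_of_pos (by norm_num : (0 : ℝ) < 3)]
      at this
  · refine (ae_restrict_mem measurableSet_uIoc).mono fun r hr => ?_
    have hr' := uIcc_subset_of_mem hs ht (uIoc_subset_uIcc hr)
    have := abs_mul_apply_le zero_le_one (abs_apply_le_one_of_mem (h.mem r hr'))
      (abs_gen_apply_le hX hY (a r) (b r)) i j
    simpa using this

theorem abs_integral_mono (h : IsTrajectory X Y T U a b) {s t r : ℝ}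
    (hs : s ∈ Icc 0 T) (ht : t ∈ Icc 0 T) (hr : r ∈ uIcc s t) :
    |∫ x in s..r, (|a x| + |b x|)| ≤ |∫ x in s..t, (|a x| + |b x|)| := by
  refine intervalIntegral.abs_integral_mono_interval ?_ ?_ (h.integrable_speed hs ht)
  · exact uIoc_subset_uIoc_of_uIcc_subset_uIcc (uIcc_subset_uIcc_left hr)
  · exact Eventually.of_forall fun x => by positivity

/-- Second order expansion of a trajectory in terms of the length of the control. -/
theorem abs_sub_sub_le (h : IsTrajectory X Y T U a b) (hX : ‖X‖ = 1) (hY : ‖Y‖ = 1) {s t : ℝ}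
    (hs : s ∈ Icc 0 T) (ht : t ∈ Icc 0 T) (i j : Fin 3) :
    |U t i j - U s i j - (U s * gen X Y (∫ r in s..t, a r) (∫ r in s..t, b r)) i j|
      ≤ 9 * (∫ r in s..t, (|a r| + |b r|)) ^ 2 := by
  set ℓ := ∫ r in s..t, (|a r| + |b r|) with hℓ
  have hia := intervalIntegrable_of_mem h.integrable_left hs ht
  have hib := intervalIntegrable_of_mem h.integrable_right hs ht
  have e : (U s * gen X Y (∫ r in s..t, a r) (∫ r in s..t, b r)) i j
      = ∫ r in s..t, (U s * gen X Y (a r) (b r)) i j := by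
    simp only [mul_gen_apply]
    rw [intervalIntegral.integral_add (hia.mul_const _) (hib.mul_const _),
      intervalIntegral.integral_mul_const, intervalIntegral.integral_mul_const]
  have his : IntervalIntegrable (fun r => (U s * gen X Y (a r) (b r)) i j) volume s t := by
    simp only [mul_gen_apply]
    exact (hia.mul_const _).add (hib.mul_const _)
  rw [e, h.sub_eq s hs t ht i j,
    ← intervalIntegral.integral_sub (h.integrable_mul_gen hs ht i j) his]
  have := intervalIntegral.norm_integral_le_abs_of_norm_le (μ := volume) (a := s) (b := t)
    (f := fun r => (U r * gen X Y (a r) (b r)) i j - (U s * gen X Y (a r) (b r)) i j)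
    (g := fun r => 9 * |ℓ| * (|a r| + |b r|)) ?_
    ((h.integrable_speed hs ht).const_mul _)
  · rw [intervalIntegral.integral_const_mul, abs_mul, ← hℓ, abs_mul, abs_abs,
      abs_of_pos (by norm_num : (0 : ℝ) < 9), mul_assoc, abs_mul_abs_self, ← sq] at this
    exact this
  · refine (ae_restrict_mem measurableSet_uIoc).mono fun r hr => ?_
    have hr' := uIcc_subset_of_mem hs ht (uIoc_subset_uIcc hr)
    -- Freezing `U` at time `s` costs `3 |ℓ|` per entry, and the product of `3 × 3` matrices
    -- contributes another factor `3`; hence the constant `9`.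
    have h1 : ∀ i j, |(U r - U s) i j| ≤ 3 * |ℓ| := fun i j =>
      (h.abs_sub_le hX hY hs hr' i j).trans (by
        gcongr 3 * ?_
        exact h.abs_integral_mono hs ht (uIoc_subset_uIcc hr))
    have := abs_mul_apply_le (by positivity) h1 (abs_gen_apply_le hX hY (a r) (b r)) i j
    rw [Matrix.sub_mul, Matrix.sub_apply] at this
    rw [Real.norm_eq_abs]
    linarith

end IsTrajectory

/-! ### From inequalities between increments to derivatives and integrals. -/

theorem hasDerivAt_zero_of_abs_le_sq {f : ℝ → ℝ} {t M : ℝ}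
    (h : ∀ᶠ r in 𝓝 t, |f r| ≤ M * (r - t) ^ 2) : HasDerivAt f 0 t := by
  have h0 : f t = 0 := by simpa using h.self_of_nhds
  rw [hasDerivAt_iff_isLittleO]
  simp only [h0, sub_zero, smul_zero]
  have h1 : f =O[𝓝 t] fun r => (r - t) ^ 2 :=
    Asymptotics.IsBigO.of_bound M (h.mono fun r hr => by simpa using hr)
  refine h1.trans_isLittleO ?_
  have : (fun r : ℝ => (r - t) ^ 2) = fun r => (r - t) * (r - t) := by ext; ring
  rw [this]
  have h2 : (fun r : ℝ => r - t) =o[𝓝 t] fun _ => (1 : ℝ) := by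
    rw [Asymptotics.isLittleO_one_iff]
    have : Continuous fun r : ℝ => r - t := by fun_prop
    simpa using this.tendsto t
  simpa using (Asymptotics.isBigO_refl (fun r : ℝ => r - t) (𝓝 t)).mul_isLittleO h2

/-- A curve satisfying the second order expansion in terms of `α`, `β` is differentiable where
`α` and `β` are. -/
theorem hasDerivAt_of_abs_sub_sub_le {X Y : EuclideanSpace ℝ (Fin 3)}
    {U : ℝ → Matrix (Fin 3) (Fin 3) ℝ} {α β : ℝ → ℝ} {t a b M : ℝ} (i j : Fin 3)
    (h : ∀ᶠ r in 𝓝 t, |U r i j - U t i j - (U t * gen X Y (α r - α t) (β r - β t)) i j|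
      ≤ M * (r - t) ^ 2) (hα : HasDerivAt α a t) (hβ : HasDerivAt β b t) :
    HasDerivAt (fun r => U r i j) ((U t * gen X Y a b) i j) t := by
  have h1 := hasDerivAt_zero_of_abs_le_sq h
  have h2 : HasDerivAt (fun r => (U t * gen X Y (α r - α t) (β r - β t)) i j)
      ((U t * gen X Y a b) i j) t := by
    simp only [mul_gen_apply]
    exact ((hα.sub_const _).mul_const _).add ((hβ.sub_const _).mul_const _)
  have h3 := (h1.add h2).add_const (U t i j)
  simp only [zero_add] at h3
  exact h3.congr_of_eventuallyEq (Eventually.of_forall fun r => by simp)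

theorem integral_deriv_of_lipschitz {f : ℝ → ℝ} {K : NNReal} (hf : LipschitzWith K f) (s t : ℝ) :
    ∫ r in s..t, deriv f r = f t - f s :=
  (hf.lipschitzOnWith (s := uIcc s t)).absolutelyContinuousOnInterval.integral_deriv_eq_sub

theorem intervalIntegrable_deriv_of_lipschitz {f : ℝ → ℝ} {K : NNReal} (hf : LipschitzWith K f)
    (s t : ℝ) : IntervalIntegrable (deriv f) volume s t :=
  (hf.lipschitzOnWith (s := uIcc s t)).absolutelyContinuousOnInterval.intervalIntegrable_deriv

theorem integrable_cost_of_lipschitz {α β : ℝ → ℝ} {K L : NNReal} (hα : LipschitzWith K α)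
    (hβ : LipschitzWith L β) (κ s t : ℝ) :
    IntervalIntegrable (fun r => |deriv α r| + κ * |deriv β r|) volume s t :=
  (intervalIntegrable_deriv_of_lipschitz hα s t).abs.add
    ((intervalIntegrable_deriv_of_lipschitz hβ s t).abs.const_mul κ)

theorem abs_deriv_add_le_of_increments {α β c : ℝ → ℝ} {κ s t r : ℝ}
    (h : ∀ x ∈ Icc s t, ∀ y ∈ Icc s t, x ≤ y → |α y - α x| + κ * |β y - β x| ≤ c y - c x)
    (hr : r ∈ Ioo s t) (h1 : DifferentiableAt ℝ α r) (h2 : DifferentiableAt ℝ β r)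
    (h3 : DifferentiableAt ℝ c r) : |deriv α r| + κ * |deriv β r| ≤ deriv c r := by
  -- The increments are only compared for `x ≤ y`, so the limit is taken over right difference
  -- quotients, which suffices as all derivatives exist.
  have hle : 𝓝[>] r ≤ 𝓝[≠] r := nhdsWithin_mono r fun x hx => ne_of_gt hx
  have t1 := h1.hasDerivAt.tendsto_slope.mono_left hle
  have t2 := h2.hasDerivAt.tendsto_slope.mono_left hle
  have t3 := h3.hasDerivAt.tendsto_slope.mono_left hle
  refine le_of_tendsto_of_tendsto (t1.abs.add (t2.abs.const_mul κ)) t3 ?_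
  have : Ioo r t ∈ 𝓝[>] r := Ioo_mem_nhdsGT hr.2
  filter_upwards [this] with x hx
  have hp : 0 < x - r := sub_pos.2 hx.1
  have := h r ⟨hr.1.le, hr.2.le⟩ x ⟨(hr.1.trans hx.1).le, hx.2.le⟩ hx.1.le
  simp only [slope_def_field, abs_div, abs_of_pos hp]
  rw [← mul_div_assoc, ← add_div]
  gcongr

/-- Lipschitz functions are differentiable almost everywhere and are the integrals of their
derivatives. This replaces lower semicontinuity of the cost: the hypothesis on increments passes to
pointwise limits, while the conclusion bounds the cost. -/
theorem integral_abs_deriv_le {α β c : ℝ → ℝ} {κ s t : ℝ} {K L M : NNReal}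
    (hα : LipschitzWith K α) (hβ : LipschitzWith L β) (hc : LipschitzWith M c) (hst : s ≤ t)
    (h : ∀ x ∈ Icc s t, ∀ y ∈ Icc s t, x ≤ y → |α y - α x| + κ * |β y - β x| ≤ c y - c x) :
    ∫ r in s..t, (|deriv α r| + κ * |deriv β r|) ≤ c t - c s := by
  rw [← integral_deriv_of_lipschitz hc]
  refine intervalIntegral.integral_mono_ae_restrict hst (integrable_cost_of_lipschitz hα hβ κ s t)
    (intervalIntegrable_deriv_of_lipschitz hc s t) ?_
  rw [← restrict_Ioo_eq_restrict_Icc]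
  filter_upwards [ae_restrict_mem measurableSet_Ioo, ae_restrict_of_ae hα.ae_differentiableAt_real,
    ae_restrict_of_ae hβ.ae_differentiableAt_real, ae_restrict_of_ae hc.ae_differentiableAt_real]
    with r hr h1 h2 h3
  exact abs_deriv_add_le_of_increments h hr h1 h2 h3

/-! ### Parametrisation by arc length. -/

/-- The projection of the real line onto `[0, L]`. -/
noncomputable def clamp (L x : ℝ) : ℝ := max 0 (min x L)

theorem clamp_mem {L : ℝ} (hL : 0 ≤ L) (x : ℝ) : clamp L x ∈ Icc 0 L :=
  ⟨le_max_left _ _, max_le hL (min_le_right _ _)⟩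

theorem clamp_of_mem {L x : ℝ} (hx : x ∈ Icc 0 L) : clamp L x = x := by
  rw [clamp, min_eq_left hx.2, max_eq_right hx.1]

theorem clamp_mono (L : ℝ) : Monotone (clamp L) := fun x y h => by
  unfold clamp; gcongr

theorem abs_clamp_sub_le (L x y : ℝ) : |clamp L x - clamp L y| ≤ |x - y| := by
  unfold clamp
  refine (abs_max_sub_max_le_max _ _ _ _).trans ?_
  refine max_le (by simp) ((abs_min_sub_min_le_max _ _ _ _).trans ?_)
  simp

/-- The length of the curve `(α, β)` on `[0, t]`. -/
noncomputable def arcLength (α β : ℝ → ℝ) (t : ℝ) : ℝ :=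
  ∫ r in (0 : ℝ)..t, (|deriv α r| + |deriv β r|)

section Lipschitz

variable {α β : ℝ → ℝ} {K : NNReal}

theorem lipschitz_of_abs_sub_le {f : ℝ → ℝ} {K : NNReal}
    (h : ∀ x y, |f x - f y| ≤ K * |x - y|) : LipschitzWith K f :=
  LipschitzWith.of_dist_le_mul fun x y => by simpa [Real.dist_eq] using h x y

theorem lipschitz_one_of_abs_sub_le {f : ℝ → ℝ} (h : ∀ x y, |f x - f y| ≤ |x - y|) :
    LipschitzWith 1 f :=
  lipschitz_of_abs_sub_le fun x y => by simpa using h x y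

theorem integrable_speed_of_lipschitz (hα : LipschitzWith K α) (hβ : LipschitzWith K β)
    (s t : ℝ) : IntervalIntegrable (fun r => |deriv α r| + |deriv β r|) volume s t := by
  simpa using integrable_cost_of_lipschitz hα hβ 1 s t

theorem arcLength_sub (hα : LipschitzWith K α) (hβ : LipschitzWith K β) (s t : ℝ) :
    arcLength α β t - arcLength α β s = ∫ r in s..t, (|deriv α r| + |deriv β r|) :=
  intervalIntegral.integral_interval_sub_left (integrable_speed_of_lipschitz hα hβ _ _)
    (integrable_speed_of_lipschitz hα hβ _ _)

theorem abs_integral_add_le {a b : ℝ → ℝ} {κ s t : ℝ} (ia : IntervalIntegrable a volume s t)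
    (ib : IntervalIntegrable b volume s t) (hκ : 0 ≤ κ) (hst : s ≤ t) :
    |∫ r in s..t, a r| + κ * |∫ r in s..t, b r| ≤ ∫ r in s..t, (|a r| + κ * |b r|) := by
  rw [intervalIntegral.integral_add ia.abs (ib.abs.const_mul κ),
    intervalIntegral.integral_const_mul]
  gcongr
  · exact intervalIntegral.abs_integral_le_integral_abs hst
  · exact intervalIntegral.abs_integral_le_integral_abs hst

theorem abs_sub_add_le_integral (hα : LipschitzWith K α) (hβ : LipschitzWith K β) {κ s t : ℝ}
    (hκ : 0 ≤ κ) (hst : s ≤ t) :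
    |α t - α s| + κ * |β t - β s| ≤ ∫ r in s..t, (|deriv α r| + κ * |deriv β r|) := by
  rw [← integral_deriv_of_lipschitz hα, ← integral_deriv_of_lipschitz hβ]
  exact abs_integral_add_le (intervalIntegrable_deriv_of_lipschitz hα s t)
    (intervalIntegrable_deriv_of_lipschitz hβ s t) hκ hst

theorem abs_sub_add_le_arcLength (hα : LipschitzWith K α) (hβ : LipschitzWith K β) (s t : ℝ) :
    |α t - α s| + |β t - β s| ≤ |arcLength α β t - arcLength α β s| := by
  rcases le_total s t with h | h
  · rw [arcLength_sub hα hβ]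
    refine le_trans ?_ (le_abs_self _)
    simpa using abs_sub_add_le_integral hα hβ zero_le_one h
  · rw [abs_sub_comm (α t), abs_sub_comm (β t), abs_sub_comm (arcLength α β t),
      arcLength_sub hα hβ]
    refine le_trans ?_ (le_abs_self _)
    simpa using abs_sub_add_le_integral hα hβ zero_le_one h

theorem abs_deriv_le (hα : LipschitzWith K α) (r : ℝ) : |deriv α r| ≤ K :=
  norm_deriv_le_of_lipschitz hα

theorem arcLength_lipschitz (hα : LipschitzWith K α) (hβ : LipschitzWith K β) :
    LipschitzWith (2 * K) (arcLength α β) := by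
  refine lipschitz_of_abs_sub_le fun x y => ?_
  rw [arcLength_sub hα hβ]
  refine intervalIntegral.norm_integral_le_of_norm_le_const (E := ℝ) fun r _ => ?_
  have h1 := abs_deriv_le hα r
  have h2 := abs_deriv_le hβ r
  rw [Real.norm_eq_abs, abs_of_nonneg (by positivity)]
  push_cast
  linarith

theorem arcLength_mono (hα : LipschitzWith K α) (hβ : LipschitzWith K β) :
    Monotone (arcLength α β) := fun x y h => by
  rw [← sub_nonneg, arcLength_sub hα hβ]
  exact intervalIntegral.integral_nonneg h fun r _ => by positivity

theorem arcLength_zero : arcLength α β 0 = 0 := intervalIntegral.integral_same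

/-- Arc length may be constant on intervals, so it has no inverse; by the intermediate value theorem
it has a section. An arbitrary one is good enough, even if discontinuous, because `α` and `β` are
constant where arc length is. -/
theorem exists_arcLength_section (hα : LipschitzWith K α) (hβ : LipschitzWith K β) {T : ℝ}
    (hT : 0 ≤ T) :
    ∃ σ : ℝ → ℝ, ∀ x, σ x ∈ Icc 0 T ∧ arcLength α β (σ x) = clamp (arcLength α β T) x := by
  have h0 : 0 ≤ arcLength α β T := by
    rw [← arcLength_zero (α := α) (β := β)]
    exact arcLength_mono hα hβ hT
  have := intermediate_value_Icc hT (arcLength_lipschitz hα hβ).continuous.continuousOn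
  rw [arcLength_zero] at this
  choose σ h1 h2 using fun x => this (clamp_mem h0 x)
  exact ⟨σ, fun x => ⟨h1 x, h2 x⟩⟩

variable {σ : ℝ → ℝ} {T : ℝ}

theorem abs_sub_add_comp_le (hα : LipschitzWith K α) (hβ : LipschitzWith K β)
    (hσ : ∀ x, arcLength α β (σ x) = clamp (arcLength α β T) x) (x y : ℝ) :
    |α (σ x) - α (σ y)| + |β (σ x) - β (σ y)| ≤ |x - y| := by
  refine (abs_sub_add_le_arcLength hα hβ _ _).trans ?_
  rw [hσ, hσ]
  exact abs_clamp_sub_le _ _ _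

theorem comp_section_lipschitz_left (hα : LipschitzWith K α) (hβ : LipschitzWith K β)
    (hσ : ∀ x, arcLength α β (σ x) = clamp (arcLength α β T) x) :
    LipschitzWith 1 (fun x => α (σ x)) :=
  lipschitz_one_of_abs_sub_le fun x y => by
    linarith [abs_sub_add_comp_le hα hβ hσ x y, abs_nonneg (β (σ x) - β (σ y))]

theorem comp_section_lipschitz_right (hα : LipschitzWith K α) (hβ : LipschitzWith K β)
    (hσ : ∀ x, arcLength α β (σ x) = clamp (arcLength α β T) x) :
    LipschitzWith 1 (fun x => β (σ x)) :=
  lipschitz_one_of_abs_sub_le fun x y => by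
    linarith [abs_sub_add_comp_le hα hβ hσ x y, abs_nonneg (α (σ x) - α (σ y))]

theorem eq_of_arcLength_eq (hα : LipschitzWith K α) (hβ : LipschitzWith K β) {s t : ℝ}
    (h : arcLength α β s = arcLength α β t) : α s = α t ∧ β s = β t := by
  have := abs_sub_add_le_arcLength hα hβ t s
  rw [h, sub_self, abs_zero] at this
  constructor
  · exact sub_eq_zero.1 (abs_nonpos_iff.1 (by linarith [abs_nonneg (β s - β t)]))
  · exact sub_eq_zero.1 (abs_nonpos_iff.1 (by linarith [abs_nonneg (α s - α t)]))

/-- The arc length parametrisation has unit speed. -/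
theorem ae_speed_eq_one (hα : LipschitzWith K α) (hβ : LipschitzWith K β) (hT : 0 ≤ T)
    (hσ : ∀ x, arcLength α β (σ x) = clamp (arcLength α β T) x) :
    ∀ᵐ x ∂volume.restrict (Ioo 0 (arcLength α β T)),
      |deriv (fun x => α (σ x)) x| + |deriv (fun x => β (σ x)) x| = 1 := by
  set L := arcLength α β T with hL
  have hmono := arcLength_mono hα hβ
  have hL0 : 0 ≤ L := by
    rw [← arcLength_zero (α := α) (β := β)]
    exact hmono hT
  set α' : ℝ → ℝ := fun x => α (σ x) with hα'def
  set β' : ℝ → ℝ := fun x => β (σ x) with hβ'def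
  have hα' : LipschitzWith 1 α' := comp_section_lipschitz_left hα hβ hσ
  have hβ' : LipschitzWith 1 β' := comp_section_lipschitz_right hα hβ hσ
  have hle : ∀ᵐ x ∂volume.restrict (Ioo 0 L), |deriv α' x| + |deriv β' x| ≤ 1 := by
    filter_upwards [ae_restrict_mem measurableSet_Ioo,
      ae_restrict_of_ae hα'.ae_differentiableAt_real,
      ae_restrict_of_ae hβ'.ae_differentiableAt_real] with r hr h1 h2
    have := abs_deriv_add_le_of_increments (α := α') (β := β') (c := id) (κ := 1) (s := 0) (t := L)
      (fun x _ y _ hxy => by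
        have := abs_sub_add_comp_le hα hβ hσ y x
        rw [abs_of_nonneg (sub_nonneg.2 hxy)] at this
        simpa using this) hr h1 h2 differentiableAt_id
    simpa using this
  have hcomp : ∀ t ∈ Icc 0 T, α' (arcLength α β t) = α t ∧ β' (arcLength α β t) = β t := by
    intro t ht
    refine eq_of_arcLength_eq hα hβ ?_
    rw [hσ, clamp_of_mem]
    exact ⟨by rw [← arcLength_zero (α := α) (β := β)]; exact hmono ht.1, hmono ht.2⟩
  -- As `α' ∘ arcLength = α` and `β' ∘ arcLength = β`, the original curve is no longer than the new
  -- one. A speed at most `1` with integral at least `L` over `[0, L]` equals `1` almost everywhere.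
  have hge : L ≤ arcLength α' β' L := by
    have := integral_abs_deriv_le (c := fun t => arcLength α' β' (arcLength α β t)) (κ := 1)
      hα hβ ((arcLength_lipschitz hα' hβ').comp (arcLength_lipschitz hα hβ)) hT
      (fun x hx y hy hxy => by
        rw [arcLength_sub hα' hβ']
        have := abs_sub_add_le_integral hα' hβ' zero_le_one (hmono hxy)
        rw [(hcomp x hx).1, (hcomp x hx).2, (hcomp y hy).1, (hcomp y hy).2] at this
        simpa using this)
    simp only [arcLength_zero, one_mul, sub_zero] at this
    exact this
  have hint := integrable_speed_of_lipschitz hα' hβ' 0 L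
  have hz : ∫ x in (0 : ℝ)..L, (1 - (|deriv α' x| + |deriv β' x|)) ≤ 0 := by
    rw [intervalIntegral.integral_sub (by simp) hint]
    simp only [intervalIntegral.integral_const, sub_zero, smul_eq_mul, mul_one]
    exact sub_nonpos.2 hge
  rw [intervalIntegral.integral_of_le hL0, integral_Ioc_eq_integral_Ioo] at hz
  have hint' : IntegrableOn (fun x => 1 - (|deriv α' x| + |deriv β' x|)) (Ioo 0 L) := by
    have h : IntervalIntegrable (fun x => 1 - (|deriv α' x| + |deriv β' x|)) volume 0 L :=
      IntervalIntegrable.sub (by simp) hint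
    exact ((intervalIntegrable_iff_integrableOn_Ioc_of_le hL0).1 h).mono_set Ioo_subset_Ioc_self
  have hnn : 0 ≤ᵐ[volume.restrict (Ioo 0 L)] fun x => 1 - (|deriv α' x| + |deriv β' x|) :=
    hle.mono fun x hx => sub_nonneg.2 hx
  have := (integral_eq_zero_iff_of_nonneg_ae hnn hint').1
    (le_antisymm hz (integral_nonneg_of_ae hnn))
  filter_upwards [this] with x hx
  have : 1 - (|deriv α' x| + |deriv β' x|) = 0 := hx
  linarith

/-- The cost does not increase when passing to the arc length parametrisation. -/
theorem integral_cost_comp_le (hα : LipschitzWith K α) (hβ : LipschitzWith K β) (hT : 0 ≤ T)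
    (hσ : ∀ x, σ x ∈ Icc 0 T ∧ arcLength α β (σ x) = clamp (arcLength α β T) x) {κ : ℝ}
    (hκ0 : 0 ≤ κ) (hκ1 : κ ≤ 1) :
    ∫ x in (0 : ℝ)..arcLength α β T,
        (|deriv (fun x => α (σ x)) x| + κ * |deriv (fun x => β (σ x)) x|)
      ≤ ∫ t in (0 : ℝ)..T, (|deriv α t| + κ * |deriv β t|) := by
  set L := arcLength α β T with hL
  have hmono := arcLength_mono hα hβ
  have hL0 : 0 ≤ L := by
    rw [← arcLength_zero (α := α) (β := β)]
    exact hmono hT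
  set c : ℝ → ℝ := fun t => ∫ r in (0 : ℝ)..t, (|deriv α r| + κ * |deriv β r|) with hc
  have hint := integrable_cost_of_lipschitz hα hβ κ
  have hcsub : ∀ s t, c t - c s = ∫ r in s..t, (|deriv α r| + κ * |deriv β r|) := fun s t =>
    intervalIntegral.integral_interval_sub_left (hint _ _) (hint _ _)
  have hcmono : Monotone c := fun x y h => by
    rw [← sub_nonneg, hcsub]
    exact intervalIntegral.integral_nonneg h fun r _ => by positivity
  have hcle : ∀ s t, |c t - c s| ≤ |arcLength α β t - arcLength α β s| := by
    have key : ∀ s t, s ≤ t → |c t - c s| ≤ |arcLength α β t - arcLength α β s| := by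
      intro s t h
      rw [abs_of_nonneg (sub_nonneg.2 (hcmono h)), abs_of_nonneg (sub_nonneg.2 (hmono h)),
        hcsub, arcLength_sub hα hβ]
      refine intervalIntegral.integral_mono_on h (hint _ _)
        (integrable_speed_of_lipschitz hα hβ _ _) fun r _ => ?_
      have := mul_le_mul_of_nonneg_right hκ1 (abs_nonneg (deriv β r))
      linarith
    intro s t
    rcases le_total s t with h | h
    · exact key s t h
    · rw [abs_sub_comm, abs_sub_comm (arcLength α β t)]
      exact key t s h
  have hcσ : LipschitzWith 1 (fun x => c (σ x)) := lipschitz_one_of_abs_sub_le fun x y => by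
    refine (hcle _ _).trans ?_
    rw [(hσ x).2, (hσ y).2]
    exact abs_clamp_sub_le _ _ _
  have hord : ∀ x y, x ≤ y → |α (σ y) - α (σ x)| + κ * |β (σ y) - β (σ x)|
      ≤ c (σ y) - c (σ x) := by
    intro x y hxy
    rcases le_total (σ x) (σ y) with h | h
    · rw [hcsub]
      exact abs_sub_add_le_integral hα hβ hκ0 h
    -- If `σ` reverses the order of `x ≤ y`, monotonicity forces equal arc lengths, and all the
    -- increments vanish.
    · have he : arcLength α β (σ x) = arcLength α β (σ y) := by
        refine le_antisymm ?_ (hmono h)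
        rw [(hσ x).2, (hσ y).2]
        exact clamp_mono _ hxy
      obtain ⟨h1, h2⟩ := eq_of_arcLength_eq hα hβ he
      have h3 := hcle (σ x) (σ y)
      rw [he, sub_self, abs_zero] at h3
      have h4 := abs_nonpos_iff.1 h3
      rw [h4, h1, h2]
      simp
  have hσ' := fun x => (hσ x).2
  have := integral_abs_deriv_le (κ := κ) (comp_section_lipschitz_left hα hβ hσ')
    (comp_section_lipschitz_right hα hβ hσ') hcσ hL0 fun x _ y _ hxy => hord x y hxy
  refine this.trans ?_
  have h1 : c 0 ≤ c (σ 0) := hcmono (hσ 0).1.1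
  have h2 : c (σ L) ≤ c T := hcmono (hσ L).1.2
  have h3 : c 0 = 0 := intervalIntegral.integral_same
  change _ ≤ c T
  linarith

end Lipschitz

/-! ### Admissible curves from Lipschitz trajectories. -/

theorem velocity_eq_of_hasDerivAt {V : ℝ → Matrix (Fin 3) (Fin 3) ℝ} {t : ℝ}
    {v : EuclideanSpace ℝ (Fin 3)} (hV : V t ∈ Matrix.specialOrthogonalGroup (Fin 3) ℝ)
    (h : ∀ i j, HasDerivAt (fun s => V s i j) ((V t * ad v) i j) t) : velocity V t = v := by
  have : matDeriv V t = V t * ad v := by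
    ext i j
    exact (h i j).deriv
  rw [velocity, this, inv_eq_transpose_of_mem hV, ← Matrix.mul_assoc,
    transpose_mul_self_of_mem hV, Matrix.one_mul, unad_ad]

/-- A Lipschitz trajectory can be reparametrised into an admissible curve which is not more
expensive. -/
theorem exists_isAdmissible_of_isTrajectory {X Y : EuclideanSpace ℝ (Fin 3)} (hX : ‖X‖ = 1)
    (hY : ‖Y‖ = 1) (hXY : LinearIndependent ℝ ![X, Y]) {κ : ℝ} (hκ0 : 0 ≤ κ) (hκ1 : κ ≤ 1)
    {g : Matrix.specialOrthogonalGroup (Fin 3) ℝ} {T : ℝ} (hT : 0 ≤ T) {α β : ℝ → ℝ} {K : NNReal}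
    (hα : LipschitzWith K α) (hβ : LipschitzWith K β) {U : ℝ → Matrix (Fin 3) (Fin 3) ℝ}
    (h : IsTrajectory X Y T U (deriv α) (deriv β)) (h0 : U 0 = 1) (hg : U T = g) :
    ∃ (L : ℝ) (V : ℝ → Matrix (Fin 3) (Fin 3) ℝ), IsAdmissible X Y g L V ∧
      totalCost κ X Y L V ≤ ∫ t in (0 : ℝ)..T, (|deriv α t| + κ * |deriv β t|) := by
  obtain ⟨σ, hσ⟩ := exists_arcLength_section hα hβ hT
  have hσ' := fun x => (hσ x).2
  set L := arcLength α β T with hL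
  have hL0 : 0 ≤ L := by
    rw [← arcLength_zero (α := α) (β := β)]
    exact arcLength_mono hα hβ hT
  set V : ℝ → Matrix (Fin 3) (Fin 3) ℝ := fun x => U (σ x) with hV
  have hα' := comp_section_lipschitz_left hα hβ hσ'
  have hβ' := comp_section_lipschitz_right hα hβ hσ'
  have hlen : ∀ x y, |∫ r in (σ x)..(σ y), (|deriv α r| + |deriv β r|)| ≤ |y - x| := fun x y => by
    rw [← arcLength_sub hα hβ, hσ', hσ']
    exact abs_clamp_sub_le _ _ _
  have hVsub : ∀ x y i j, |V y i j - V x i j| ≤ 3 * |y - x| := fun x y i j =>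
    (h.abs_sub_le hX hY (hσ x).1 (hσ y).1 i j).trans (by gcongr 3 * ?_; exact hlen x y)
  -- The section need not send `0` to `0` or `L` to `T`, but `U` too depends only on the arc length,
  -- so the end points are still the right ones.
  have hend : ∀ x t, t ∈ Icc 0 T → arcLength α β t = clamp L x → V x = U t := by
    intro x t ht hx
    ext i j
    have := h.abs_sub_le hX hY ht (hσ x).1 i j
    rw [← arcLength_sub hα hβ, hσ', hx, sub_self, abs_zero, mul_zero] at this
    exact sub_eq_zero.1 (abs_nonpos_iff.1 this)
  have hmem : ∀ x, V x ∈ Matrix.specialOrthogonalGroup (Fin 3) ℝ := fun x => h.mem _ (hσ x).1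
  have hderiv : ∀ᵐ x ∂volume.restrict (Icc 0 L),
      (∀ i j, HasDerivAt (fun s => V s i j)
        ((V x * ad (deriv (fun x => α (σ x)) x • X + deriv (fun x => β (σ x)) x • Y)) i j) x) ∧
      |deriv (fun x => α (σ x)) x| + |deriv (fun x => β (σ x)) x| = 1 := by
    rw [← restrict_Ioo_eq_restrict_Icc]
    filter_upwards [ae_speed_eq_one hα hβ hT hσ', ae_restrict_of_ae hα'.ae_differentiableAt_real,
      ae_restrict_of_ae hβ'.ae_differentiableAt_real] with x hx h1 h2
    refine ⟨fun i j => ?_, hx⟩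
    refine hasDerivAt_of_abs_sub_sub_le (M := 9) i j (Eventually.of_forall fun y => ?_)
      h1.hasDerivAt h2.hasDerivAt
    have := h.abs_sub_sub_le hX hY (hσ x).1 (hσ y).1 i j
    rw [integral_deriv_of_lipschitz hα, integral_deriv_of_lipschitz hβ] at this
    refine this.trans ?_
    gcongr 9 * ?_
    exact sq_le_sq.2 (hlen x y)
  have hvel : ∀ᵐ x ∂volume.restrict (Icc 0 L), velocity V x
      = deriv (fun x => α (σ x)) x • X + deriv (fun x => β (σ x)) x • Y :=
    hderiv.mono fun x hx => velocity_eq_of_hasDerivAt (hmem x) hx.1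
  refine ⟨L, V, ⟨hL0, fun t _ => hmem t, fun i j => ?_, ?_, ?_, ?_⟩, ?_⟩
  · exact ((lipschitz_of_abs_sub_le (K := 3)
      fun x y => hVsub y x i j).lipschitzOnWith).absolutelyContinuousOnInterval
  · rw [hend 0 0 ⟨le_rfl, hT⟩, h0]
    rw [arcLength_zero, clamp_of_mem ⟨le_rfl, hL0⟩]
  · rw [hend L T ⟨hT, le_rfl⟩, hg]
    rw [← hL, clamp_of_mem ⟨hL0, le_rfl⟩]
  · filter_upwards [hderiv, hvel] with x h1 h2
    rw [h2]
    exact ⟨h1.1, _, _, h1.2, rfl⟩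
  · refine le_trans (le_of_eq ?_) (integral_cost_comp_le hα hβ hT hσ hκ0 hκ1)
    refine intervalIntegral.integral_congr_ae_restrict ?_
    rw [uIoc_of_le hL0, restrict_Ioc_eq_restrict_Icc]
    filter_upwards [hvel] with x hx
    rw [hx, cost_apply κ hXY]

/-! ### Adapted frames and integrable controls. -/

/-- A positively oriented orthonormal frame `P` adapted to the pair `X`, `Y`: its last column
is `Y`, and `X` is the combination of the first and the last column with coefficients `S > 0`
and `ρ`. -/
structure IsFrame (X Y : EuclideanSpace ℝ (Fin 3)) (P : Matrix (Fin 3) (Fin 3) ℝ) (S ρ : ℝ) :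
    Prop where
  mem : P ∈ Matrix.specialOrthogonalGroup (Fin 3) ℝ
  pos : 0 < S
  sq_add_sq : S ^ 2 + ρ ^ 2 = 1
  right : ∀ i, Y i = P i 2
  left : ∀ i, X i = S * P i 0 + ρ * P i 2

/-- The middle column is `y × w`; its norm and the determinant come from Lagrange's identity. -/
theorem frame_mem {w y : Fin 3 → ℝ} (hw : w 0 ^ 2 + w 1 ^ 2 + w 2 ^ 2 = 1)
    (hy : y 0 ^ 2 + y 1 ^ 2 + y 2 ^ 2 = 1) (hwy : w 0 * y 0 + w 1 * y 1 + w 2 * y 2 = 0) :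
    !![w 0, y 1 * w 2 - y 2 * w 1, y 0; w 1, y 2 * w 0 - y 0 * w 2, y 1;
      w 2, y 0 * w 1 - y 1 * w 0, y 2] ∈ Matrix.specialOrthogonalGroup (Fin 3) ℝ := by
  refine mem_specialOrthogonal_of ?_ ?_
  · ext i j
    fin_cases i <;> fin_cases j <;>
      simp [Matrix.mul_apply, Fin.sum_univ_three]
    · linear_combination hw
    · ring
    · linear_combination hwy
    · ring
    · linear_combination hw * (y 0 ^ 2 + y 1 ^ 2 + y 2 ^ 2) + hy
        - (w 0 * y 0 + w 1 * y 1 + w 2 * y 2) * hwy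
    · ring
    · linear_combination hwy
    · ring
    · linear_combination hy
  · simp [Matrix.det_fin_three]
    linear_combination hw * (y 0 ^ 2 + y 1 ^ 2 + y 2 ^ 2) + hy
        - (w 0 * y 0 + w 1 * y 1 + w 2 * y 2) * hwy

/-- Gram–Schmidt: `ρ` and `S` are the cosine and the sine of the angle between `X` and `Y`, and `S >
0` is their linear independence. -/
theorem exists_isFrame {X Y : EuclideanSpace ℝ (Fin 3)} (hX : ‖X‖ = 1) (hY : ‖Y‖ = 1)
    (hXY : LinearIndependent ℝ ![X, Y]) : ∃ P S ρ, IsFrame X Y P S ρ := by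
  have sq : ∀ v : EuclideanSpace ℝ (Fin 3), v 0 ^ 2 + v 1 ^ 2 + v 2 ^ 2 = ‖v‖ ^ 2 := fun v => by
    rw [EuclideanSpace.real_norm_sq_eq, Fin.sum_univ_three]
  have hx := sq X
  have hy := sq Y
  rw [hX] at hx
  rw [hY] at hy
  set ρ := X 0 * Y 0 + X 1 * Y 1 + X 2 * Y 2 with hρ
  have hne : X - ρ • Y ≠ 0 := fun h0 => by
    have := (LinearIndependent.pair_iff.1 hXY 1 (-ρ) (by rw [← h0]; module)).1
    exact one_ne_zero this
  have h1 := sq (X - ρ • Y)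
  have h2 : 0 < ‖X - ρ • Y‖ := norm_pos_iff.2 hne
  set S := ‖X - ρ • Y‖ with hS
  simp only [PiLp.sub_apply, PiLp.smul_apply, smul_eq_mul] at h1
  have hS2 : S ^ 2 + ρ ^ 2 = 1 := by
    linear_combination -h1 + hx + ρ ^ 2 * hy + 2 * ρ * hρ
  let w : Fin 3 → ℝ := fun i => (X i - ρ * Y i) / S
  have hSw : ∀ i, S * w i = X i - ρ * Y i := fun i => by
    simp only [w]; field_simp
  have hw : w 0 ^ 2 + w 1 ^ 2 + w 2 ^ 2 = 1 := by
    simp only [w]; field_simp; linarith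
  have hwy : w 0 * Y 0 + w 1 * Y 1 + w 2 * Y 2 = 0 := by
    have : S * (w 0 * Y 0 + w 1 * Y 1 + w 2 * Y 2) = 0 := by
      linear_combination Y 0 * hSw 0 + Y 1 * hSw 1 + Y 2 * hSw 2 - ρ * hy - hρ
    exact (mul_eq_zero.1 this).resolve_left h2.ne'
  refine ⟨_, S, ρ, frame_mem (w := w) (y := Y) hw (by simpa using hy) hwy, h2, hS2, ?_, ?_⟩
  · intro i
    fin_cases i <;> simp
  · intro i
    fin_cases i <;> simp [hSw]

theorem column_inner {P : Matrix (Fin 3) (Fin 3) ℝ}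
    (hP : P ∈ Matrix.specialOrthogonalGroup (Fin 3) ℝ) (i j : Fin 3) :
    P 0 i * P 0 j + P 1 i * P 1 j + P 2 i * P 2 j = if i = j then 1 else 0 := by
  have := congrFun (congrFun (transpose_mul_self_of_mem hP) i) j
  simpa [Matrix.mul_apply, Fin.sum_univ_three, Matrix.one_apply] using this

/-- Admissibility provides the coefficients of the velocity only pointwise. Reading them off
linearly from inner products with the frame makes them integrable functions of time. -/
theorem IsAdmissible.exists_isTrajectory {X Y : EuclideanSpace ℝ (Fin 3)} (hX : ‖X‖ = 1)
    (hY : ‖Y‖ = 1) (hXY : LinearIndependent ℝ ![X, Y])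
    {g : Matrix.specialOrthogonalGroup (Fin 3) ℝ} {T : ℝ} {V : ℝ → Matrix (Fin 3) (Fin 3) ℝ}
    (h : IsAdmissible X Y g T V) : ∃ a b : ℝ → ℝ, IsTrajectory X Y T V a b ∧
      ∀ᵐ t ∂volume.restrict (Icc 0 T), velocity V t = a t • X + b t • Y ∧ |a t| + |b t| = 1 ∧
        ∀ i j, HasDerivAt (fun s => V s i j) ((V t * gen X Y (a t) (b t)) i j) t := by
  obtain ⟨P, S, ρ, hP⟩ := exists_isFrame hX hY hXY
  have hT := h.nonneg
  have hcont : ∀ i j, ContinuousOn (fun t => V t i j) (Icc 0 T) := fun i j => by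
    rw [← uIcc_of_le hT]
    exact (h.absolutelyContinuous i j).continuousOn
  have hent : ∀ i j, IntervalIntegrable (fun t => ((V t)⁻¹ * matDeriv V t) i j) volume 0 T := by
    intro i j
    have h1 : IntervalIntegrable (fun t => ∑ k, V t k i * deriv (fun s => V s k j) t)
        volume 0 T := by
      have hk := fun k => ((h.absolutelyContinuous k j).intervalIntegrable_deriv).continuousOn_mul
        (h.absolutelyContinuous k i).continuousOn
      simp only [Fin.sum_univ_three]
      exact ((hk 0).add (hk 1)).add (hk 2)
    refine h1.congr fun t ht => ?_
    have ht' : t ∈ Icc 0 T := by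
      rw [uIoc_of_le hT] at ht; exact ⟨ht.1.le, ht.2⟩
    rw [inv_eq_transpose_of_mem (h.mem t ht')]
    simp [Matrix.mul_apply, matDeriv]
  have hvel : ∀ k, IntervalIntegrable (fun t => velocity V t k) volume 0 T := by
    intro k
    fin_cases k
    · simpa [velocity, unad] using hent 2 1
    · simpa [velocity, unad] using hent 0 2
    · simpa [velocity, unad] using hent 1 0
  have hcol : ∀ j, IntervalIntegrable (fun t => velocity V t 0 * P 0 j + velocity V t 1 * P 1 j
      + velocity V t 2 * P 2 j) volume 0 T := fun j =>
    (((hvel 0).mul_const _).add ((hvel 1).mul_const _)).add ((hvel 2).mul_const _)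
  let a : ℝ → ℝ := fun t => (velocity V t 0 * P 0 0 + velocity V t 1 * P 1 0
      + velocity V t 2 * P 2 0) / S
  let b : ℝ → ℝ := fun t => (velocity V t 0 * P 0 2 + velocity V t 1 * P 1 2
      + velocity V t 2 * P 2 2) - ρ * a t
  have ha : IntervalIntegrable a volume 0 T := (hcol 0).div_const S
  have hb : IntervalIntegrable b volume 0 T := (hcol 2).sub (ha.const_mul ρ)
  have hS := hP.pos.ne'
  have hae : ∀ᵐ t ∂volume.restrict (Icc 0 T), velocity V t = a t • X + b t • Y ∧
      |a t| + |b t| = 1 ∧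
      ∀ i j, HasDerivAt (fun s => V s i j) ((V t * gen X Y (a t) (b t)) i j) t := by
    filter_upwards [h.control] with t ht
    obtain ⟨p, q, hpq, hv⟩ := ht.2
    have hc : ∀ k, velocity V t k = p * X k + q * Y k := fun k => by rw [hv]; simp
    have c00 := column_inner hP.mem 0 0
    have c20 := column_inner hP.mem 2 0
    have c22 := column_inner hP.mem 2 2
    simp at c00 c20 c22
    -- The inner products of `pX + qY` with the first and last column of `P` are `p S` and `p ρ +
    -- q`.
    have hap : a t = p := by
      simp only [a, hc, hP.left, hP.right]
      field_simp
      linear_combination p * S * c00 + (p * ρ + q) * c20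
    have hbq : b t = q := by
      simp only [b, hap, hc, hP.left, hP.right]
      linear_combination p * S * c20 + (p * ρ + q) * c22
    rw [hap, hbq]
    refine ⟨hv, hpq, fun i j => ?_⟩
    have := ht.1 i j
    rwa [hv] at this
  refine ⟨a, b, ⟨h.mem, hcont, ha, hb, fun s hs t ht i j => ?_⟩, hae⟩
  have hsub : uIcc s t ⊆ uIcc 0 T := (uIcc_subset_of_mem hs ht).trans Icc_subset_uIcc
  rw [← ((h.absolutelyContinuous i j).mono hsub).integral_deriv_eq_sub]
  refine intervalIntegral.integral_congr_ae_restrict ?_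
  have hsub' : uIoc s t ⊆ Icc 0 T := uIoc_subset_uIcc.trans (uIcc_subset_of_mem hs ht)
  filter_upwards [ae_restrict_of_ae_restrict_of_subset hsub' hae] with r hr
  exact (hr.2.2 i j).deriv

theorem integral_eq_sub_of_ae_eq_one {f : ℝ → ℝ} {T : ℝ}
    (h : ∀ᵐ t ∂volume.restrict (Icc 0 T), f t = 1) :
    ∀ s ∈ Icc 0 T, ∀ t ∈ Icc 0 T, ∫ r in s..t, f r = t - s := by
  intro s hs t ht
  have : ∫ r in s..t, f r = ∫ r in s..t, (1 : ℝ) :=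
    intervalIntegral.integral_congr_ae_restrict (ae_restrict_of_ae_restrict_of_subset
      (uIoc_subset_uIcc.trans (uIcc_subset_of_mem hs ht)) h)
  rw [this]; simp

theorem totalCost_eq_integral {X Y : EuclideanSpace ℝ (Fin 3)}
    (hXY : LinearIndependent ℝ ![X, Y]) (κ : ℝ) {T : ℝ} (hT : 0 ≤ T)
    {V : ℝ → Matrix (Fin 3) (Fin 3) ℝ} {a b : ℝ → ℝ}
    (h : ∀ᵐ t ∂volume.restrict (Icc 0 T), velocity V t = a t • X + b t • Y) :
    totalCost κ X Y T V = ∫ t in (0 : ℝ)..T, (|a t| + κ * |b t|) := by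
  refine intervalIntegral.integral_congr_ae_restrict ?_
  rw [uIoc_of_le hT, restrict_Ioc_eq_restrict_Icc]
  filter_upwards [h] with t ht
  rw [ht, cost_apply κ hXY]

/-! ### Compactness of relaxed curves and existence for positive `κ`. -/

/-- Matrix-valued curves together with the integrated controls and the running cost. -/
abbrev Path : Type := (ℝ → Matrix (Fin 3) (Fin 3) ℝ) × (ℝ → ℝ) × (ℝ → ℝ) × (ℝ → ℝ)

/-- The closed relaxation of the set of admissible curves on `[0, T]`: `(U, α, β, c)` where `α`
and `β` are the integrated controls and `c` bounds the running cost. -/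
structure IsRelaxed (κ : ℝ) (X Y : EuclideanSpace ℝ (Fin 3))
    (g : Matrix.specialOrthogonalGroup (Fin 3) ℝ) (T : ℝ) (p : Path) : Prop where
  mem : ∀ t, p.1 t ∈ Matrix.specialOrthogonalGroup (Fin 3) ℝ
  init : p.1 0 = 1
  final : p.1 T = g
  left_zero : p.2.1 0 = 0
  right_zero : p.2.2.1 0 = 0
  cost_zero : p.2.2.2 0 = 0
  length_le : ∀ s t, |p.2.1 t - p.2.1 s| + |p.2.2.1 t - p.2.2.1 s| ≤ |t - s|
  cost_le : ∀ s t, |p.2.2.2 t - p.2.2.2 s| ≤ |t - s|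
  le_cost : ∀ s t, s ≤ t →
    |p.2.1 t - p.2.1 s| + κ * |p.2.2.1 t - p.2.2.1 s| ≤ p.2.2.2 t - p.2.2.2 s
  expansion : ∀ s t i j, |p.1 t i j - p.1 s i j
    - (p.1 s * gen X Y (p.2.1 t - p.2.1 s) (p.2.2.1 t - p.2.2.1 s)) i j| ≤ 9 * (t - s) ^ 2

theorem isClosed_setOf_isRelaxed (κ : ℝ) (X Y : EuclideanSpace ℝ (Fin 3))
    (g : Matrix.specialOrthogonalGroup (Fin 3) ℝ) (T : ℝ) :
    IsClosed {p : Path | IsRelaxed κ X Y g T p} := by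
  have hU : ∀ t, Continuous fun p : Path => p.1 t := fun t =>
    (continuous_apply t).comp continuous_fst
  have hUe : ∀ t i j, Continuous fun p : Path => p.1 t i j := fun t i j =>
    (hU t).matrix_elem i j
  have hα : ∀ t, Continuous fun p : Path => p.2.1 t := fun t => by fun_prop
  have hβ : ∀ t, Continuous fun p : Path => p.2.2.1 t := fun t => by fun_prop
  have hc : ∀ t, Continuous fun p : Path => p.2.2.2 t := fun t => by fun_prop
  have hUZ : ∀ t Z i j, Continuous fun p : Path => (p.1 t * ad Z) i j := fun t Z i j =>
    ((hU t).matrix_mul continuous_const).matrix_elem i j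
  -- Each condition, with the expansion written out linearly in the increments of `α` and `β`, is an
  -- equation or a weak inequality between continuous functions of finitely many values.
  have e : {p : Path | IsRelaxed κ X Y g T p} =
      {p | ∀ t, (p.1 t)ᵀ * p.1 t = 1} ∩ {p | ∀ t, (p.1 t).det = 1} ∩ {p | p.1 0 = 1} ∩
      {p | p.1 T = (g : Matrix (Fin 3) (Fin 3) ℝ)} ∩ {p | p.2.1 0 = 0} ∩ {p | p.2.2.1 0 = 0} ∩ {p | p.2.2.2 0 = 0} ∩
      {p | ∀ s t, |p.2.1 t - p.2.1 s| + |p.2.2.1 t - p.2.2.1 s| ≤ |t - s|} ∩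
      {p | ∀ s t, |p.2.2.2 t - p.2.2.2 s| ≤ |t - s|} ∩
      {p | ∀ s t, s ≤ t →
        |p.2.1 t - p.2.1 s| + κ * |p.2.2.1 t - p.2.2.1 s| ≤ p.2.2.2 t - p.2.2.2 s} ∩
      {p | ∀ s t i j, |p.1 t i j - p.1 s i j - ((p.2.1 t - p.2.1 s) * (p.1 s * ad X) i j
        + (p.2.2.1 t - p.2.2.1 s) * (p.1 s * ad Y) i j)| ≤ 9 * (t - s) ^ 2} := by
    ext p
    constructor
    · intro h
      refine ⟨⟨⟨⟨⟨⟨⟨⟨⟨⟨fun t => transpose_mul_self_of_mem (h.mem t), fun t =>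
        (mem_specialOrthogonalGroup_iff.1 (h.mem t)).2⟩, h.init⟩, h.final⟩, h.left_zero⟩,
        h.right_zero⟩, h.cost_zero⟩, h.length_le⟩, h.cost_le⟩, h.le_cost⟩, fun s t i j => ?_⟩
      rw [← mul_gen_apply]
      exact h.expansion s t i j
    · rintro ⟨⟨⟨⟨⟨⟨⟨⟨⟨⟨h1, h2⟩, h3⟩, h4⟩, h5⟩, h6⟩, h7⟩, h8⟩, h9⟩, h10⟩, h11⟩
      refine ⟨fun t => mem_specialOrthogonal_of (h1 t) (h2 t), h3, h4, h5, h6, h7, h8, h9, h10,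
        fun s t i j => ?_⟩
      rw [mul_gen_apply]
      exact h11 s t i j
  rw [e]
  simp only [ofPred_forall]
  refine IsClosed.inter (IsClosed.inter (IsClosed.inter (IsClosed.inter (IsClosed.inter
    (IsClosed.inter (IsClosed.inter (IsClosed.inter (IsClosed.inter (IsClosed.inter
    ?_ ?_) ?_) ?_) ?_) ?_) ?_) ?_) ?_) ?_) ?_
  · exact isClosed_iInter fun t =>
      isClosed_eq ((hU t).matrix_transpose.matrix_mul (hU t)) continuous_const
  · exact isClosed_iInter fun t => isClosed_eq (hU t).matrix_det continuous_const
  · exact isClosed_eq (hU 0) continuous_const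
  · exact isClosed_eq (hU T) continuous_const
  · exact isClosed_eq (hα 0) continuous_const
  · exact isClosed_eq (hβ 0) continuous_const
  · exact isClosed_eq (hc 0) continuous_const
  · exact isClosed_iInter fun s => isClosed_iInter fun t => isClosed_le
      ((((hα t).sub (hα s)).abs).add (((hβ t).sub (hβ s)).abs)) continuous_const
  · exact isClosed_iInter fun s => isClosed_iInter fun t => isClosed_le
      ((hc t).sub (hc s)).abs continuous_const
  · exact isClosed_iInter fun s => isClosed_iInter fun t => isClosed_iInter fun _ => isClosed_le
      ((((hα t).sub (hα s)).abs).add ((((hβ t).sub (hβ s)).abs).const_mul κ))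
      ((hc t).sub (hc s))
  · exact isClosed_iInter fun s => isClosed_iInter fun t => isClosed_iInter fun i =>
      isClosed_iInter fun j => isClosed_le
        ((((hUe t i j).sub (hUe s i j)).sub ((((hα t).sub (hα s)).mul (hUZ s X i j)).add
          (((hβ t).sub (hβ s)).mul (hUZ s Y i j)))).abs) continuous_const

/-- In the topology of pointwise convergence Tychonoff suffices: entries of rotations lie in `[-1,
1]`, and the other components are bounded by `|t|` because they vanish at `0`. -/
theorem isCompact_setOf_isRelaxed (κ : ℝ) (X Y : EuclideanSpace ℝ (Fin 3))
    (g : Matrix.specialOrthogonalGroup (Fin 3) ℝ) (T : ℝ) :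
    IsCompact {p : Path | IsRelaxed κ X Y g T p} := by
  let B : Set (ℝ → Matrix (Fin 3) (Fin 3) ℝ) :=
    univ.pi fun _ => univ.pi fun _ => univ.pi fun _ => Icc (-1) 1
  let C : Set (ℝ → ℝ) := univ.pi fun t => Icc (-|t|) |t|
  have hB : IsCompact B := isCompact_univ_pi fun _ => isCompact_univ_pi fun _ =>
    isCompact_univ_pi fun _ => isCompact_Icc
  have hC : IsCompact C := isCompact_univ_pi fun _ => isCompact_Icc
  refine (hB.prod (hC.prod (hC.prod hC))).of_isClosed_subset
    (isClosed_setOf_isRelaxed κ X Y g T) fun p hp => ⟨?_, ?_, ?_, ?_⟩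
  · exact fun t _ i _ j _ => abs_le.1 (abs_apply_le_one_of_mem (hp.mem t) i j)
  · intro t _
    have := hp.length_le 0 t
    rw [hp.left_zero, sub_zero, sub_zero] at this
    exact abs_le.1 (by linarith [abs_nonneg (p.2.2.1 t - p.2.2.1 0)])
  · intro t _
    have := hp.length_le 0 t
    rw [hp.right_zero, sub_zero, sub_zero] at this
    exact abs_le.1 (by linarith [abs_nonneg (p.2.1 t - p.2.1 0)])
  · intro t _
    have := hp.cost_le 0 t
    rw [hp.cost_zero, sub_zero, sub_zero] at this
    exact abs_le.1 this

/-- Every admissible curve gives, after stopping at its final time, a relaxed one. -/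
theorem IsAdmissible.exists_isRelaxed {X Y : EuclideanSpace ℝ (Fin 3)} (hX : ‖X‖ = 1)
    (hY : ‖Y‖ = 1) (hXY : LinearIndependent ℝ ![X, Y]) {κ : ℝ} (hκ0 : 0 ≤ κ) (hκ1 : κ ≤ 1)
    {g : Matrix.specialOrthogonalGroup (Fin 3) ℝ} {s₀ T : ℝ} {V : ℝ → Matrix (Fin 3) (Fin 3) ℝ}
    (h : IsAdmissible X Y g s₀ V) (hT : s₀ ≤ T) :
    ∃ p, IsRelaxed κ X Y g T p ∧ p.2.2.2 T = totalCost κ X Y s₀ V := by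
  obtain ⟨a, b, htr, hae⟩ := h.exists_isTrajectory hX hY hXY
  have hs₀ := h.nonneg
  have h00 : (0 : ℝ) ∈ Icc 0 s₀ := ⟨le_rfl, hs₀⟩
  have hcl := clamp_mem hs₀
  have hia := fun {s t : ℝ} (hs : s ∈ Icc 0 s₀) (ht : t ∈ Icc 0 s₀) =>
    intervalIntegrable_of_mem htr.integrable_left hs ht
  have hib := fun {s t : ℝ} (hs : s ∈ Icc 0 s₀) (ht : t ∈ Icc 0 s₀) =>
    intervalIntegrable_of_mem htr.integrable_right hs ht
  have hic := fun {s t : ℝ} (hs : s ∈ Icc 0 s₀) (ht : t ∈ Icc 0 s₀) =>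
    (hia hs ht).abs.add ((hib hs ht).abs.const_mul κ)
  have hlen : ∀ s ∈ Icc 0 s₀, ∀ t ∈ Icc 0 s₀, ∫ r in s..t, (|a r| + |b r|) = t - s :=
    integral_eq_sub_of_ae_eq_one (hae.mono fun t ht => ht.2.1)
  let α : ℝ → ℝ := fun t => ∫ r in (0 : ℝ)..t, a r
  let β : ℝ → ℝ := fun t => ∫ r in (0 : ℝ)..t, b r
  let c : ℝ → ℝ := fun t => ∫ r in (0 : ℝ)..t, (|a r| + κ * |b r|)
  have hα : ∀ s ∈ Icc 0 s₀, ∀ t ∈ Icc 0 s₀, α t - α s = ∫ r in s..t, a r := fun s hs t ht =>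
    intervalIntegral.integral_interval_sub_left (hia h00 ht) (hia h00 hs)
  have hβ : ∀ s ∈ Icc 0 s₀, ∀ t ∈ Icc 0 s₀, β t - β s = ∫ r in s..t, b r := fun s hs t ht =>
    intervalIntegral.integral_interval_sub_left (hib h00 ht) (hib h00 hs)
  have hc : ∀ s ∈ Icc 0 s₀, ∀ t ∈ Icc 0 s₀, c t - c s = ∫ r in s..t, (|a r| + κ * |b r|) :=
    fun s hs t ht => intervalIntegral.integral_interval_sub_left (hic h00 ht) (hic h00 hs)
  have hle : ∀ s ∈ Icc 0 s₀, ∀ t ∈ Icc 0 s₀, s ≤ t → ∀ μ, 0 ≤ μ →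
      |α t - α s| + μ * |β t - β s| ≤ ∫ r in s..t, (|a r| + μ * |b r|) := by
    intro s hs t ht hst μ hμ
    rw [hα s hs t ht, hβ s hs t ht]
    exact abs_integral_add_le (hia hs ht) (hib hs ht) hμ hst
  have hlen1 : ∀ s ∈ Icc 0 s₀, ∀ t ∈ Icc 0 s₀, s ≤ t →
      |α t - α s| + |β t - β s| ≤ |t - s| := by
    intro s hs t ht hst
    have := hle s hs t ht hst 1 zero_le_one
    simp only [one_mul] at this
    rw [hlen s hs t ht] at this
    exact this.trans (le_abs_self _)
  have hlen2 : ∀ s ∈ Icc 0 s₀, ∀ t ∈ Icc 0 s₀, |α t - α s| + |β t - β s| ≤ |t - s| := by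
    intro s hs t ht
    rcases le_total s t with hst | hst
    · exact hlen1 s hs t ht hst
    · rw [abs_sub_comm (α t), abs_sub_comm (β t), abs_sub_comm t]
      exact hlen1 t ht s hs hst
  have hcabs : ∀ s ∈ Icc 0 s₀, ∀ t ∈ Icc 0 s₀, |c t - c s| ≤ |t - s| := by
    intro s hs t ht
    rw [hc s hs t ht]
    have : ‖∫ r in s..t, (|a r| + κ * |b r|)‖ ≤ |∫ r in s..t, (|a r| + |b r|)| := by
      refine intervalIntegral.norm_integral_le_abs_of_norm_le (Eventually.of_forall fun r => ?_)
        (htr.integrable_speed hs ht)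
      rw [Real.norm_eq_abs, abs_of_nonneg (by positivity)]
      have := mul_le_mul_of_nonneg_right hκ1 (abs_nonneg (b r))
      linarith
    rwa [hlen s hs t ht] at this
  have hclamp : ∀ s t, |clamp s₀ t - clamp s₀ s| ≤ |t - s| := fun s t => abs_clamp_sub_le _ _ _
  have hc0 : clamp s₀ 0 = 0 := clamp_of_mem h00
  have hcT : clamp s₀ T = s₀ := by
    rw [clamp, min_eq_right hT, max_eq_right hs₀]
  -- The curve rests at `g` after time `s₀`; resting is allowed in the relaxed problem and costs
  -- nothing, so all competitors fit on one interval `[0, T]`.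
  refine ⟨⟨fun t => V (clamp s₀ t), fun t => α (clamp s₀ t), fun t => β (clamp s₀ t),
    fun t => c (clamp s₀ t)⟩, ⟨fun t => h.mem _ (hcl t), ?_, ?_, ?_, ?_, ?_,
      fun s t => (hlen2 _ (hcl s) _ (hcl t)).trans (hclamp s t),
      fun s t => (hcabs _ (hcl s) _ (hcl t)).trans (hclamp s t), fun s t hst => ?_,
      fun s t i j => ?_⟩, ?_⟩
  · simp only [hc0, h.init]
  · simp only [hcT, h.final]
  · simp only [hc0]; exact intervalIntegral.integral_same
  · simp only [hc0]; exact intervalIntegral.integral_same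
  · simp only [hc0]; exact intervalIntegral.integral_same
  · rw [hc _ (hcl s) _ (hcl t)]
    exact hle _ (hcl s) _ (hcl t) (clamp_mono _ hst) κ hκ0
  · have := htr.abs_sub_sub_le hX hY (hcl s) (hcl t) i j
    rw [hlen _ (hcl s) _ (hcl t), ← hα _ (hcl s) _ (hcl t), ← hβ _ (hcl s) _ (hcl t)] at this
    refine this.trans ?_
    gcongr 9 * ?_
    exact sq_le_sq.2 (hclamp s t)
  · simp only [hcT]
    exact (totalCost_eq_integral hXY κ hs₀ (hae.mono fun r hr => hr.1)).symm

/-- Every relaxed curve dominates an admissible one. -/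
theorem IsRelaxed.exists_isAdmissible {X Y : EuclideanSpace ℝ (Fin 3)} (hX : ‖X‖ = 1)
    (hY : ‖Y‖ = 1) (hXY : LinearIndependent ℝ ![X, Y]) {κ : ℝ} (hκ0 : 0 ≤ κ) (hκ1 : κ ≤ 1)
    {g : Matrix.specialOrthogonalGroup (Fin 3) ℝ} {T : ℝ} (hT : 0 ≤ T) {p : Path}
    (h : IsRelaxed κ X Y g T p) : ∃ (L : ℝ) (V : ℝ → Matrix (Fin 3) (Fin 3) ℝ),
      IsAdmissible X Y g L V ∧ totalCost κ X Y L V ≤ p.2.2.2 T := by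
  obtain ⟨U, α, β, c⟩ := p
  have hα : LipschitzWith 1 α := lipschitz_one_of_abs_sub_le fun x y => by
    have := h.length_le y x
    dsimp only at this
    linarith [abs_nonneg (β x - β y)]
  have hβ : LipschitzWith 1 β := lipschitz_one_of_abs_sub_le fun x y => by
    have := h.length_le y x
    dsimp only at this
    linarith [abs_nonneg (α x - α y)]
  have hc : LipschitzWith 1 c := lipschitz_one_of_abs_sub_le fun x y => h.cost_le y x
  have hd : ∀ᵐ t : ℝ, ∀ i j,
      HasDerivAt (fun s => U s i j) ((U t * gen X Y (deriv α t) (deriv β t)) i j) t := by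
    filter_upwards [hα.ae_differentiableAt_real, hβ.ae_differentiableAt_real] with t h1 h2 i j
    exact hasDerivAt_of_abs_sub_sub_le (M := 9) i j
      (Eventually.of_forall fun r => h.expansion t r i j) h1.hasDerivAt h2.hasDerivAt
  -- The linear term contributes `3 |t - s|`, and the remainder `9 (t - s) ^ 2` is at most `9 T |t -
  -- s|`.
  have hLip : ∀ i j, ∀ s ∈ Icc 0 T, ∀ t ∈ Icc 0 T,
      |U t i j - U s i j| ≤ (9 * T + 3) * |t - s| := by
    intro i j s hs t ht
    have h1 := h.expansion s t i j
    have h2 := abs_mul_apply_le zero_le_one (abs_apply_le_one_of_mem (h.mem s))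
      (fun i j => (abs_gen_apply_le hX hY _ _ i j).trans (h.length_le s t)) i j
    dsimp only at h1 h2
    have h3 : |t - s| ≤ T := abs_le.2 ⟨by linarith [hs.2, ht.1], by linarith [ht.2, hs.1]⟩
    have h4 := abs_sub_abs_le_abs_sub (U t i j - U s i j)
      ((U s * gen X Y (α t - α s) (β t - β s)) i j)
    have h5 : (t - s) ^ 2 ≤ T * |t - s| := by
      rw [← sq_abs, sq]
      exact mul_le_mul_of_nonneg_right h3 (abs_nonneg _)
    linarith
  have hAC : ∀ i j, AbsolutelyContinuousOnInterval (fun t => U t i j) 0 T := by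
    intro i j
    refine LipschitzOnWith.absolutelyContinuousOnInterval (K := ⟨9 * T + 3, by positivity⟩) ?_
    rw [uIcc_of_le hT]
    refine LipschitzOnWith.of_dist_le_mul fun x hx y hy => ?_
    rw [Real.dist_eq, Real.dist_eq]
    exact hLip i j y hy x hx
  have htr : IsTrajectory X Y T U (deriv α) (deriv β) := by
    refine ⟨fun t _ => h.mem t, fun i j => ?_, intervalIntegrable_deriv_of_lipschitz hα _ _,
      intervalIntegrable_deriv_of_lipschitz hβ _ _, fun s hs t ht i j => ?_⟩
    · rw [← uIcc_of_le hT]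
      exact (hAC i j).continuousOn
    · have hsub : uIcc s t ⊆ uIcc 0 T := (uIcc_subset_of_mem hs ht).trans Icc_subset_uIcc
      rw [← ((hAC i j).mono hsub).integral_deriv_eq_sub]
      refine intervalIntegral.integral_congr_ae_restrict ?_
      filter_upwards [ae_restrict_of_ae hd] with r hr
      exact (hr i j).deriv
  obtain ⟨L, V, hV, hcost⟩ :=
    exists_isAdmissible_of_isTrajectory hX hY hXY hκ0 hκ1 hT hα hβ htr h.init h.final
  refine ⟨L, V, hV, hcost.trans ?_⟩
  have := integral_abs_deriv_le (κ := κ) hα hβ hc hT fun x _ y _ hxy => h.le_cost x y hxy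
  have h0 : c 0 = 0 := h.cost_zero
  rw [h0, sub_zero] at this
  exact this

theorem IsAdmissible.mul_le_totalCost {X Y : EuclideanSpace ℝ (Fin 3)} (hX : ‖X‖ = 1)
    (hY : ‖Y‖ = 1) (hXY : LinearIndependent ℝ ![X, Y]) {κ : ℝ} (hκ1 : κ ≤ 1)
    {g : Matrix.specialOrthogonalGroup (Fin 3) ℝ} {s₀ : ℝ} {V : ℝ → Matrix (Fin 3) (Fin 3) ℝ}
    (h : IsAdmissible X Y g s₀ V) : κ * s₀ ≤ totalCost κ X Y s₀ V := by
  obtain ⟨a, b, htr, hae⟩ := h.exists_isTrajectory hX hY hXY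
  have hs₀ := h.nonneg
  have e2 : κ * s₀ = ∫ r in (0 : ℝ)..s₀, κ := by simp [mul_comm]
  rw [totalCost_eq_integral hXY κ hs₀ (hae.mono fun r hr => hr.1), e2]
  refine intervalIntegral.integral_mono_ae_restrict hs₀ (by simp)
    (htr.integrable_left.abs.add (htr.integrable_right.abs.const_mul κ)) ?_
  filter_upwards [hae] with r hr
  have h1 := hr.2.1
  have := mul_le_mul_of_nonneg_right hκ1 (abs_nonneg (a r))
  have h2 : κ * |a r| + κ * |b r| = κ := by rw [← mul_add, h1, mul_one]
  linarith

/-- For `κ > 0` an optimal curve exists as soon as there is an admissible one. -/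
theorem exists_isOptimal_of_pos {X Y : EuclideanSpace ℝ (Fin 3)} (hX : ‖X‖ = 1)
    (hY : ‖Y‖ = 1) (hXY : LinearIndependent ℝ ![X, Y]) {κ : ℝ} (hκ0 : 0 < κ) (hκ1 : κ ≤ 1)
    {g : Matrix.specialOrthogonalGroup (Fin 3) ℝ} {s₁ : ℝ} {V₁ : ℝ → Matrix (Fin 3) (Fin 3) ℝ}
    (h₁ : IsAdmissible X Y g s₁ V₁) : ∃ t₀ U, IsOptimal κ X Y g t₀ U := by
  set C := totalCost κ X Y s₁ V₁ with hC
  -- All curves costing at most `C` end by time `C / κ`, which serves as the common horizon; more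
  -- expensive ones need not be considered.
  have hbound : ∀ s V, IsAdmissible X Y g s V → totalCost κ X Y s V ≤ C → s ≤ C / κ := by
    intro s V hV hle
    rw [le_div_iff₀ hκ0, mul_comm]
    exact (hV.mul_le_totalCost hX hY hXY hκ1).trans hle
  have hs₁ := hbound s₁ V₁ h₁ le_rfl
  have hT : 0 ≤ C / κ := h₁.nonneg.trans hs₁
  obtain ⟨p₁, hp₁, hp₁c⟩ := h₁.exists_isRelaxed hX hY hXY hκ0.le hκ1 hs₁
  obtain ⟨p, hp, hmin⟩ := (isCompact_setOf_isRelaxed κ X Y g (C / κ)).exists_isMinOn ⟨p₁, hp₁⟩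
    (f := fun p : Path => p.2.2.2 (C / κ)) (by fun_prop)
  obtain ⟨L, V, hV, hcost⟩ := IsRelaxed.exists_isAdmissible hX hY hXY hκ0.le hκ1 hT hp
  refine ⟨L, V, hV, fun s W hW => hcost.trans ?_⟩
  rcases le_total (totalCost κ X Y s W) C with hle | hle
  · obtain ⟨q, hq, hqc⟩ := hW.exists_isRelaxed hX hY hXY hκ0.le hκ1 (hbound s W hW hle)
    rw [← hqc]
    exact hmin hq
  · exact (hmin hp₁).trans (hp₁c.le.trans hle)

/-! ### Rotations about coordinate axes and Euler angles. -/

/-- Rotation about the third coordinate axis. -/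
noncomputable def rotZ (θ : ℝ) : Matrix (Fin 3) (Fin 3) ℝ :=
  !![Real.cos θ, -Real.sin θ, 0; Real.sin θ, Real.cos θ, 0; 0, 0, 1]

/-- Rotation about the first coordinate axis. -/
noncomputable def rotX (θ : ℝ) : Matrix (Fin 3) (Fin 3) ℝ :=
  !![1, 0, 0; 0, Real.cos θ, -Real.sin θ; 0, Real.sin θ, Real.cos θ]

theorem rotZ_zero : rotZ 0 = 1 := by
  ext i j
  fin_cases i <;> fin_cases j <;> simp [rotZ]

theorem rotX_zero : rotX 0 = 1 := by
  ext i j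
  fin_cases i <;> fin_cases j <;> simp [rotX]

theorem rotZ_mem (θ : ℝ) : rotZ θ ∈ Matrix.specialOrthogonalGroup (Fin 3) ℝ := by
  have h := Real.sin_sq_add_cos_sq θ
  refine mem_specialOrthogonal_of ?_ ?_
  · ext i j
    fin_cases i <;> fin_cases j <;> simp [rotZ, Matrix.mul_apply, Fin.sum_univ_three] <;>
      first | ring1 | linear_combination h
  · simp [rotZ, Matrix.det_fin_three]
    linear_combination h

theorem rotX_mem (θ : ℝ) : rotX θ ∈ Matrix.specialOrthogonalGroup (Fin 3) ℝ := by
  have h := Real.sin_sq_add_cos_sq θ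
  refine mem_specialOrthogonal_of ?_ ?_
  · ext i j
    fin_cases i <;> fin_cases j <;> simp [rotX, Matrix.mul_apply, Fin.sum_univ_three] <;>
      first | ring1 | linear_combination h
  · simp [rotX, Matrix.det_fin_three]
    linear_combination h

theorem hasDerivAt_rotZ (θ : ℝ) (i j : Fin 3) :
    HasDerivAt (fun s => rotZ s i j) ((rotZ θ * ad !₂[0, 0, 1]) i j) θ := by
  have hc := Real.hasDerivAt_cos θ
  have hs := Real.hasDerivAt_sin θ
  fin_cases i <;> fin_cases j <;>
    simp [rotZ, ad, Matrix.mul_apply, Fin.sum_univ_three, hasDerivAt_const] <;>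
    first | exact hc | exact hs | exact hs.neg

theorem hasDerivAt_rotX (θ : ℝ) (i j : Fin 3) :
    HasDerivAt (fun s => rotX s i j) ((rotX θ * ad !₂[1, 0, 0]) i j) θ := by
  have hc := Real.hasDerivAt_cos θ
  have hs := Real.hasDerivAt_sin θ
  fin_cases i <;> fin_cases j <;>
    simp [rotX, ad, Matrix.mul_apply, Fin.sum_univ_three, hasDerivAt_const] <;>
    first | exact hc | exact hs | exact hs.neg

theorem exists_polar (x y : ℝ) :
    ∃ θ : ℝ, √(x ^ 2 + y ^ 2) * Real.cos θ = x ∧ √(x ^ 2 + y ^ 2) * Real.sin θ = y := by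
  have hn : ‖(⟨x, y⟩ : ℂ)‖ = √(x ^ 2 + y ^ 2) := by
    rw [Complex.norm_def, Complex.normSq_apply]
    congr 1; ring
  refine ⟨Complex.arg ⟨x, y⟩, ?_, ?_⟩
  · rw [← hn]; exact Complex.norm_mul_cos_arg _
  · rw [← hn]; exact Complex.norm_mul_sin_arg _

theorem row_inner {P : Matrix (Fin 3) (Fin 3) ℝ}
    (hP : P ∈ Matrix.specialOrthogonalGroup (Fin 3) ℝ) (i j : Fin 3) :
    P i 0 * P j 0 + P i 1 * P j 1 + P i 2 * P j 2 = if i = j then 1 else 0 := by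
  have := congrFun (congrFun (mul_transpose_self_of_mem hP) i) j
  simpa [Matrix.mul_apply, Fin.sum_univ_three, Matrix.one_apply] using this

theorem transpose_mem {P : Matrix (Fin 3) (Fin 3) ℝ}
    (hP : P ∈ Matrix.specialOrthogonalGroup (Fin 3) ℝ) :
    Pᵀ ∈ Matrix.specialOrthogonalGroup (Fin 3) ℝ := by
  refine mem_specialOrthogonal_of ?_ ?_
  · rw [transpose_transpose]; exact mul_transpose_self_of_mem hP
  · rw [det_transpose]; exact (mem_specialOrthogonalGroup_iff.1 hP).2

theorem exists_eq_rotZ {h : Matrix (Fin 3) (Fin 3) ℝ}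
    (hh : h ∈ Matrix.specialOrthogonalGroup (Fin 3) ℝ) (h0 : h 0 2 = 0) (h1 : h 1 2 = 0)
    (h2 : h 2 2 = 1) : ∃ ψ, h = rotZ ψ := by
  have r22 := row_inner hh 2 2
  have c00 := column_inner hh 0 0
  have c01 := column_inner hh 0 1
  have hd : h.det = 1 := (mem_specialOrthogonalGroup_iff.1 hh).2
  rw [Matrix.det_fin_three] at hd
  simp [h2] at r22 c00 c01
  have h20 : h 2 0 = 0 := by nlinarith [mul_self_nonneg (h 2 0), mul_self_nonneg (h 2 1)]
  have h21 : h 2 1 = 0 := by nlinarith [mul_self_nonneg (h 2 0), mul_self_nonneg (h 2 1)]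
  rw [h20] at c00 c01 hd
  rw [h21] at hd
  rw [h0, h1, h2] at hd
  obtain ⟨ψ, hc, hs⟩ := exists_polar (h 0 0) (h 1 0)
  have hsq : h 0 0 ^ 2 + h 1 0 ^ 2 = 1 := by linear_combination c00
  rw [hsq, Real.sqrt_one, one_mul] at hc hs
  have h11 : h 1 1 = h 0 0 := by
    linear_combination -h 1 1 * hsq + h 0 0 * hd + h 1 0 * c01
  have h01 : h 0 1 = - h 1 0 := by
    linear_combination -h 0 1 * hsq - h 1 0 * hd + h 0 0 * c01
  refine ⟨ψ, ?_⟩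
  ext i j
  fin_cases i <;> fin_cases j <;> simp [rotZ, h0, h1, h2, h20, h21, h11, h01, hc, hs]

/-- Euler angles, the second one in terms of the last entry of the matrix. -/
theorem exists_euler {g : Matrix (Fin 3) (Fin 3) ℝ}
    (hg : g ∈ Matrix.specialOrthogonalGroup (Fin 3) ℝ) :
    ∃ φ ψ, g = rotZ φ * rotX (Real.arccos (g 2 2)) * rotZ ψ := by
  have c22 := column_inner hg 2 2
  simp at c22
  have hz := abs_le.1 (abs_apply_le_one_of_mem hg 2 2)
  -- The last column of `rotZ φ * rotX τ` is `(sin φ sin τ, -cos φ sin τ, cos τ)`. Matching it with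
  -- that of `g` leaves a rotation fixing the third axis.
  obtain ⟨φ, hc, hs⟩ := exists_polar (-g 1 2) (g 0 2)
  set τ := Real.arccos (g 2 2) with hτ
  have hcos : Real.cos τ = g 2 2 := Real.cos_arccos hz.1 hz.2
  have hsin : Real.sin τ = √((-g 1 2) ^ 2 + g 0 2 ^ 2) := by
    rw [hτ, Real.sin_arccos]
    congr 1
    linear_combination -c22
  rw [← hsin] at hc hs
  have hR : rotZ φ * rotX τ ∈ Matrix.specialOrthogonalGroup (Fin 3) ℝ :=
    mul_mem (rotZ_mem φ) (rotX_mem τ)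
  have hm := mul_mem (transpose_mem hR) hg
  have hcol : ∀ i, g i 2 = (rotZ φ * rotX τ) i 2 := by
    intro i
    fin_cases i
    · simp [rotZ, rotX, Matrix.mul_apply, Fin.sum_univ_three]
      linarith
    · simp [rotZ, rotX, Matrix.mul_apply, Fin.sum_univ_three]
      linarith
    · simp [rotZ, rotX, Matrix.mul_apply, Fin.sum_univ_three, hcos]
  have hcol2 : ∀ i, ((rotZ φ * rotX τ)ᵀ * g) i 2 = (1 : Matrix (Fin 3) (Fin 3) ℝ) i 2 := by
    intro i
    rw [← transpose_mul_self_of_mem hR, Matrix.mul_apply, Matrix.mul_apply]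
    simp only [hcol]
  obtain ⟨ψ, hψ⟩ := exists_eq_rotZ hm ((hcol2 0).trans (by simp)) ((hcol2 1).trans (by simp))
    ((hcol2 2).trans (by simp))
  refine ⟨φ, ψ, ?_⟩
  rw [← hψ, ← Matrix.mul_assoc, mul_transpose_self_of_mem hR, Matrix.one_mul]

/-- This is `det (Pu, Pv, Pw) = det P · det (u, v, w)` in matrix form; for rotations it says that
`ad` is equivariant. -/
theorem transpose_mul_ad_mul (P : Matrix (Fin 3) (Fin 3) ℝ) (v : EuclideanSpace ℝ (Fin 3)) :
    Pᵀ * ad !₂[P 0 0 * v 0 + P 0 1 * v 1 + P 0 2 * v 2,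
      P 1 0 * v 0 + P 1 1 * v 1 + P 1 2 * v 2, P 2 0 * v 0 + P 2 1 * v 1 + P 2 2 * v 2] * P
      = P.det • ad v := by
  ext i j
  fin_cases i <;> fin_cases j <;>
    simp [ad, Matrix.mul_apply, Fin.sum_univ_three, Matrix.det_fin_three] <;> ring

namespace IsFrame

variable {X Y : EuclideanSpace ℝ (Fin 3)} {P : Matrix (Fin 3) (Fin 3) ℝ} {S ρ : ℝ}

theorem transpose_mul_ad_right_mul (h : IsFrame X Y P S ρ) :
    Pᵀ * ad Y * P = ad !₂[0, 0, 1] := by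
  have := transpose_mul_ad_mul P !₂[0, 0, 1]
  rw [(mem_specialOrthogonalGroup_iff.1 h.mem).2, one_smul] at this
  rw [← this]
  congr 3
  ext i
  fin_cases i <;> simp [h.right]

theorem transpose_mul_ad_left_mul (h : IsFrame X Y P S ρ) :
    Pᵀ * ad X * P = S • ad !₂[1, 0, 0] + ρ • ad !₂[0, 0, 1] := by
  have := transpose_mul_ad_mul P !₂[S, 0, ρ]
  rw [(mem_specialOrthogonalGroup_iff.1 h.mem).2, one_smul] at this
  rw [← ad_smul, ← ad_smul, ← ad_add]
  have e : S • !₂[1, 0, 0] + ρ • !₂[0, 0, 1] = (!₂[S, 0, ρ] : EuclideanSpace ℝ (Fin 3)) := by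
    ext i; fin_cases i <;> simp
  rw [e, ← this]
  congr 3
  ext i
  fin_cases i <;> simp [h.left] <;> ring

theorem transpose_mul_gen_mul (h : IsFrame X Y P S ρ) (a b : ℝ) :
    Pᵀ * gen X Y a b * P = (a * S) • ad !₂[1, 0, 0] + (a * ρ + b) • ad !₂[0, 0, 1] := by
  rw [gen_eq, Matrix.mul_add, Matrix.add_mul, Matrix.mul_smul, Matrix.mul_smul, Matrix.smul_mul,
    Matrix.smul_mul, h.transpose_mul_ad_left_mul, h.transpose_mul_ad_right_mul]
  module

theorem transpose_mul_gen (h : IsFrame X Y P S ρ) (a b : ℝ) :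
    Pᵀ * gen X Y a b
      = ((a * S) • ad !₂[1, 0, 0] + (a * ρ + b) • ad !₂[0, 0, 1]) * Pᵀ := by
  rw [← h.transpose_mul_gen_mul, Matrix.mul_assoc, mul_transpose_self_of_mem h.mem, Matrix.mul_one]

end IsFrame

theorem hasDerivAt_mul_mul_apply {M : ℝ → Matrix (Fin 3) (Fin 3) ℝ} {M' : Matrix (Fin 3) (Fin 3) ℝ}
    {t : ℝ} (h : ∀ i j, HasDerivAt (fun s => M s i j) (M' i j) t)
    (A B : Matrix (Fin 3) (Fin 3) ℝ) (i j : Fin 3) :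
    HasDerivAt (fun s => (A * M s * B) i j) ((A * M' * B) i j) t := by
  simp only [Matrix.mul_apply]
  exact HasDerivAt.fun_sum fun k _ => (HasDerivAt.fun_sum fun l _ => (h l k).const_mul _).mul_const _

theorem clamp_of_nonpos {L x : ℝ} (hx : x ≤ 0) : clamp L x = 0 :=
  max_eq_left ((min_le_left _ _).trans hx)

theorem clamp_of_le {L x : ℝ} (hL : 0 ≤ L) (hx : L ≤ x) : clamp L x = L := by
  rw [clamp, min_eq_right hx, max_eq_right hL]

/-! ### A curve through Euler angles. -/

/-- The concatenation of a rotation by `φ` about the third axis, by `τ` about the first axis, and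
by `ψ` about the third axis of the frame `P`, each of them in unit time. -/
noncomputable def eulerCurve (P : Matrix (Fin 3) (Fin 3) ℝ) (φ τ ψ t : ℝ) :
    Matrix (Fin 3) (Fin 3) ℝ :=
  P * (rotZ (φ * clamp 1 t) * rotX (τ * clamp 1 (t - 1)) * rotZ (ψ * clamp 1 (t - 2))) * Pᵀ

/-- The integrated first control of `eulerCurve`. -/
noncomputable def eulerLeft (S τ t : ℝ) : ℝ := τ / S * clamp 1 (t - 1)

/-- The integrated second control of `eulerCurve`. -/
noncomputable def eulerRight (S ρ φ τ ψ t : ℝ) : ℝ :=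
  φ * clamp 1 t - τ * ρ / S * clamp 1 (t - 1) + ψ * clamp 1 (t - 2)

theorem clamp_lipschitz (L : ℝ) : LipschitzWith 1 (clamp L) :=
  lipschitz_one_of_abs_sub_le fun x y => abs_clamp_sub_le L x y

theorem lipschitz_mul_clamp (c d : ℝ) :
    LipschitzWith ‖c‖₊ (fun t => c * clamp 1 (t - d)) := by
  refine lipschitz_of_abs_sub_le fun x y => ?_
  rw [← mul_sub, abs_mul, coe_nnnorm, Real.norm_eq_abs]
  gcongr |c| * ?_
  simpa using abs_clamp_sub_le 1 (x - d) (y - d)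

theorem exists_lipschitz_euler (S ρ φ τ ψ : ℝ) : ∃ K : NNReal,
    LipschitzWith K (eulerLeft S τ) ∧ LipschitzWith K (eulerRight S ρ φ τ ψ) := by
  have h1 := lipschitz_mul_clamp (τ / S) 1
  have h2 : LipschitzWith _ (eulerRight S ρ φ τ ψ) :=
    ((by simpa using lipschitz_mul_clamp φ 0 :
      LipschitzWith ‖φ‖₊ fun t => φ * clamp 1 t).sub
      (lipschitz_mul_clamp (τ * ρ / S) 1)).add (lipschitz_mul_clamp ψ 2)
  exact ⟨_, h1.weaken (le_max_left _ _), h2.weaken (le_max_right _ _)⟩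

theorem hasDerivAt_euler {X Y : EuclideanSpace ℝ (Fin 3)} {P : Matrix (Fin 3) (Fin 3) ℝ} {S ρ : ℝ}
    (hP : IsFrame X Y P S ρ) (φ τ ψ : ℝ) {t : ℝ} (ht : t ∈ Ioo 0 3 \ {1, 2}) (i j : Fin 3) :
    HasDerivAt (fun s => eulerCurve P φ τ ψ s i j) ((eulerCurve P φ τ ψ t *
      gen X Y (deriv (eulerLeft S τ) t) (deriv (eulerRight S ρ φ τ ψ) t)) i j) t := by
  have hS := hP.pos.ne'
  -- On each unit interval only one factor moves, at angular speed `ω`, between a constant matrix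
  -- `A` and `Pᵀ`; `key` treats the three cases at once.
  have key : ∀ (R : ℝ → Matrix (Fin 3) (Fin 3) ℝ) (D : Matrix (Fin 3) (Fin 3) ℝ)
      (A : Matrix (Fin 3) (Fin 3) ℝ) (ω d a b : ℝ) (α β : ℝ → ℝ),
      (∀ θ i j, HasDerivAt (fun s => R s i j) ((R θ * D) i j) θ) →
      HasDerivAt α a t → HasDerivAt β b t →
      (a * S) • ad !₂[1, 0, 0] + (a * ρ + b) • ad !₂[0, 0, 1] = ω • D →
      (∀ᶠ s in 𝓝 t, eulerCurve P φ τ ψ s = A * R (ω * (s - d)) * Pᵀ ∧ eulerLeft S τ s = α s ∧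
        eulerRight S ρ φ τ ψ s = β s) →
      HasDerivAt (fun s => eulerCurve P φ τ ψ s i j) ((eulerCurve P φ τ ψ t *
        gen X Y (deriv (eulerLeft S τ) t) (deriv (eulerRight S ρ φ τ ψ) t)) i j) t := by
    intro R D A ω d a b α β hR hα hβ hD hev
    have hα' : deriv (eulerLeft S τ) t = a :=
      (hα.congr_of_eventuallyEq (hev.mono fun s hs => hs.2.1)).deriv
    have hβ' : deriv (eulerRight S ρ φ τ ψ) t = b :=
      (hβ.congr_of_eventuallyEq (hev.mono fun s hs => hs.2.2)).deriv
    have hlin : HasDerivAt (fun s => ω * (s - d)) ω t := by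
      simpa using ((hasDerivAt_id t).sub_const d).const_mul ω
    have h1 : ∀ i j, HasDerivAt (fun s => R (ω * (s - d)) i j)
        ((R (ω * (t - d)) * (ω • D)) i j) t := fun i j => by
      have := (hR (ω * (t - d)) i j).comp t hlin
      rw [Matrix.mul_smul, Matrix.smul_apply, smul_eq_mul, mul_comm]
      exact this
    have h2 := hasDerivAt_mul_mul_apply h1 A Pᵀ i j
    rw [hα', hβ', hev.self_of_nhds.1, Matrix.mul_assoc _ Pᵀ, hP.transpose_mul_gen, hD]
    simp only [← Matrix.mul_assoc] at h2 ⊢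
    exact h2.congr_of_eventuallyEq (hev.mono fun s hs => by
      simp only [hs.1])
  obtain ⟨⟨h0, h3⟩, hne⟩ := ht
  simp only [mem_insert_iff, mem_singleton_iff, not_or] at hne
  have hid : ∀ c d : ℝ, HasDerivAt (fun s : ℝ => c * (s - d)) c t := fun c d => by
    simpa using ((hasDerivAt_id t).sub_const d).const_mul c
  rcases lt_or_gt_of_ne hne.1 with h1 | h1
  · refine key rotZ _ P φ 0 0 φ (fun _ => 0) (fun s => φ * (s - 0)) hasDerivAt_rotZ
      (hasDerivAt_const _ _) (hid φ 0) (by simp) ?_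
    filter_upwards [Ioo_mem_nhds h0 h1] with s hs
    have e1 : clamp 1 s = s := clamp_of_mem ⟨hs.1.le, hs.2.le⟩
    have e2 : clamp 1 (s - 1) = 0 := clamp_of_nonpos (by linarith [hs.2])
    have e3 : clamp 1 (s - 2) = 0 := clamp_of_nonpos (by linarith [hs.2])
    simp [eulerCurve, eulerLeft, eulerRight, e1, e2, e3, rotZ_zero, rotX_zero]
  rcases lt_or_gt_of_ne hne.2 with h2 | h2
  -- Since `X = S e + ρ Y` with `e` the first column of `P`, turning about `e` at speed `τ` takes `a
  -- = τ / S`, and `b = -τ ρ / S` cancels the part along `Y`.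
  · refine key rotX _ (P * rotZ φ) τ 1 (τ / S) (-(τ * ρ / S)) (fun s => τ / S * (s - 1))
      (fun s => φ + -(τ * ρ / S) * (s - 1)) hasDerivAt_rotX (hid _ _)
      ((hid _ _).const_add φ) ?_ ?_
    · have e1 : τ / S * S = τ := by field_simp
      have e2 : τ / S * ρ + -(τ * ρ / S) = 0 := by ring
      rw [e1, e2, zero_smul, add_zero]
    · filter_upwards [Ioo_mem_nhds h1 h2] with s hs
      have e1 : clamp 1 s = 1 := clamp_of_le zero_le_one hs.1.le
      have e2 : clamp 1 (s - 1) = s - 1 :=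
        clamp_of_mem ⟨by linarith [hs.1], by linarith [hs.2]⟩
      have e3 : clamp 1 (s - 2) = 0 := clamp_of_nonpos (by linarith [hs.2])
      refine ⟨?_, ?_, ?_⟩
      · simp [eulerCurve, e1, e2, e3, rotZ_zero, Matrix.mul_assoc]
      · simp [eulerLeft, e2]
      · simp only [eulerRight, e1, e2, e3]; ring
  · refine key rotZ _ (P * rotZ φ * rotX τ) ψ 2 0 ψ (fun _ => τ / S)
      (fun s => (φ - τ * ρ / S) + ψ * (s - 2)) hasDerivAt_rotZ (hasDerivAt_const _ _)
      ((hid _ _).const_add _) (by simp) ?_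
    filter_upwards [Ioo_mem_nhds h2 h3] with s hs
    have e1 : clamp 1 s = 1 := clamp_of_le zero_le_one (by linarith [hs.1])
    have e2 : clamp 1 (s - 1) = 1 := clamp_of_le zero_le_one (by linarith [hs.1])
    have e3 : clamp 1 (s - 2) = s - 2 := clamp_of_mem ⟨by linarith [hs.1], by linarith [hs.2]⟩
    refine ⟨?_, ?_, ?_⟩
    · simp [eulerCurve, e1, e2, e3, Matrix.mul_assoc]
    · simp [eulerLeft, e2]
    · simp only [eulerRight, e1, e2, e3]; ring

theorem continuous_eulerCurve (P : Matrix (Fin 3) (Fin 3) ℝ) (φ τ ψ : ℝ) :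
    Continuous (eulerCurve P φ τ ψ) := by
  have hZ : Continuous rotZ := continuous_matrix fun i j =>
    continuous_iff_continuousAt.2 fun θ => (hasDerivAt_rotZ θ i j).continuousAt
  have hX : Continuous rotX := continuous_matrix fun i j =>
    continuous_iff_continuousAt.2 fun θ => (hasDerivAt_rotX θ i j).continuousAt
  have hc := (clamp_lipschitz 1).continuous
  unfold eulerCurve
  fun_prop

theorem isTrajectory_euler {X Y : EuclideanSpace ℝ (Fin 3)} {P : Matrix (Fin 3) (Fin 3) ℝ}
    {S ρ : ℝ} (hP : IsFrame X Y P S ρ) (φ τ ψ : ℝ) :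
    IsTrajectory X Y 3 (eulerCurve P φ τ ψ) (deriv (eulerLeft S τ))
      (deriv (eulerRight S ρ φ τ ψ)) := by
  obtain ⟨K, hα, hβ⟩ := exists_lipschitz_euler S ρ φ τ ψ
  have hc : ∀ i j, Continuous fun t => eulerCurve P φ τ ψ t i j := fun i j =>
    (continuous_eulerCurve P φ τ ψ).matrix_elem i j
  refine ⟨fun t _ => mul_mem (mul_mem hP.mem (mul_mem (mul_mem (rotZ_mem _) (rotX_mem _))
    (rotZ_mem _))) (transpose_mem hP.mem), fun i j => (hc i j).continuousOn,
    intervalIntegrable_deriv_of_lipschitz hα _ _, intervalIntegrable_deriv_of_lipschitz hβ _ _,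
    fun s hs t ht i j => ?_⟩
  refine (integral_eq_of_hasDerivAt_off_countable (s := {1, 2}) _ _
    (by simp) (hc i j).continuousOn (fun r hr => ?_) ?_).symm
  · refine hasDerivAt_euler hP φ τ ψ ⟨⟨?_, ?_⟩, hr.2⟩ i j
    · exact (le_min hs.1 ht.1).trans_lt hr.1.1
    · exact hr.1.2.trans_le (max_le hs.2 ht.2)
  · exact intervalIntegrable_mul_gen (fun i j => (hc i j).continuousOn)
      (intervalIntegrable_deriv_of_lipschitz hα _ _)
      (intervalIntegrable_deriv_of_lipschitz hβ _ _) i j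

/-- With `κ = 0` only the first control is paid for. Its integral `eulerLeft` rises monotonically
from `0` to `τ / S`, so it can serve as its own cost bound. -/
theorem exists_isAdmissible {X Y : EuclideanSpace ℝ (Fin 3)} (hX : ‖X‖ = 1)
    (hY : ‖Y‖ = 1) (hXY : LinearIndependent ℝ ![X, Y])
    (g : Matrix.specialOrthogonalGroup (Fin 3) ℝ) {P : Matrix (Fin 3) (Fin 3) ℝ} {S ρ : ℝ}
    (hP : IsFrame X Y P S ρ) : ∃ (L : ℝ) (V : ℝ → Matrix (Fin 3) (Fin 3) ℝ),
      IsAdmissible X Y g L V ∧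
      totalCost 0 X Y L V ≤ Real.arccos ((Pᵀ * (g : Matrix (Fin 3) (Fin 3) ℝ) * P) 2 2) / S := by
  obtain ⟨φ, ψ, he⟩ := exists_euler (mul_mem (mul_mem (transpose_mem hP.mem) g.2) hP.mem)
  set τ := Real.arccos ((Pᵀ * (g : Matrix (Fin 3) (Fin 3) ℝ) * P) 2 2) with hτ
  obtain ⟨K, hα, hβ⟩ := exists_lipschitz_euler S ρ φ τ ψ
  have hc : ∀ x : ℝ, x ≤ 0 → clamp 1 x = 0 := fun x hx => clamp_of_nonpos hx
  have hc' : ∀ x : ℝ, 1 ≤ x → clamp 1 x = 1 := fun x hx => clamp_of_le zero_le_one hx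
  have h0 : eulerCurve P φ τ ψ 0 = 1 := by
    rw [eulerCurve, hc _ (by norm_num), hc _ (by norm_num), hc _ (by norm_num)]
    simp [rotZ_zero, rotX_zero, mul_transpose_self_of_mem hP.mem]
  have h3 : eulerCurve P φ τ ψ 3 = g := by
    rw [eulerCurve, hc' _ (by norm_num), hc' _ (by norm_num), hc' _ (by norm_num), mul_one,
      mul_one, mul_one, ← he]
    simp only [Matrix.mul_assoc, mul_transpose_self_of_mem hP.mem, Matrix.mul_one]
    rw [← Matrix.mul_assoc, mul_transpose_self_of_mem hP.mem, Matrix.one_mul]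
  obtain ⟨L, V, hV, hcost⟩ := exists_isAdmissible_of_isTrajectory hX hY hXY le_rfl zero_le_one
    (by norm_num) hα hβ (isTrajectory_euler hP φ τ ψ) h0 h3
  refine ⟨L, V, hV, hcost.trans ?_⟩
  have hpos : 0 ≤ τ / S := div_nonneg (Real.arccos_nonneg _) hP.pos.le
  have := integral_abs_deriv_le (κ := 0) (s := 0) (t := 3) hα hβ hα (by norm_num)
    fun x _ y _ hxy => by
      have : eulerLeft S τ x ≤ eulerLeft S τ y := by
        unfold eulerLeft
        gcongr
        exact clamp_mono 1 (by linarith)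
      rw [zero_mul, add_zero, abs_of_nonneg (sub_nonneg.2 this)]
  refine this.trans (le_of_eq ?_)
  rw [eulerLeft, eulerLeft, hc' _ (by norm_num), hc _ (by norm_num)]
  ring

/-! ### The lower bound for `κ = 0`. -/

/-- The absence of `q` reflects that turning about the third axis does not change the angle which
that axis makes with its image. -/
theorem mul_ad_apply_two (M : Matrix (Fin 3) (Fin 3) ℝ) (p q : ℝ) :
    (M * (p • ad !₂[1, 0, 0] + q • ad !₂[0, 0, 1])) 2 2 = -(p * M 2 1) := by
  simp [Matrix.mul_apply, Fin.sum_univ_three, ad]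
  ring

theorem lipschitzOn_arcsin {r : ℝ} (hr1 : r < 1) :
    ∃ K, LipschitzOnWith K Real.arcsin (Icc (-r) r) := by
  refine ContDiffOn.exists_lipschitzOnWith (n := 1) (fun x hx => ?_) (by simp)
    (convex_Icc _ _) isCompact_Icc
  exact (Real.contDiffAt_arcsin (by linarith [hx.1]) (by linarith [hx.2])).contDiffWithinAt

/-- A Lipschitz curve `f` in `[-1, 1]` with `f 0 = 1` and `|f'| ≤ ρ √(1 - f²)` descends by an angle
of at most `∫ ρ`. -/
theorem arccos_le_integral {f ρ : ℝ → ℝ} {T : ℝ} {K : NNReal} (hT : 0 ≤ T)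
    (hf : LipschitzOnWith K f (Icc 0 T)) (hf1 : ∀ t ∈ Icc 0 T, |f t| ≤ 1) (h0 : f 0 = 1)
    (hρ0 : ∀ t, 0 ≤ ρ t) (hρ : IntervalIntegrable ρ volume 0 T)
    (hd : ∀ᵐ t ∂volume.restrict (Icc 0 T), ∃ f', HasDerivAt f f' t ∧
      |f'| ≤ ρ t * √(1 - f t ^ 2)) :
    Real.arccos (f T) ≤ ∫ t in (0 : ℝ)..T, ρ t := by
  -- `arcsin` is not Lipschitz up to `±1`, and `f` starts at `1`. Scaling by `r < 1` keeps `r f` in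
  -- an interval where the chain rule and absolute continuity hold; then `r → 1`.
  have key : ∀ r ∈ Ioo (0 : ℝ) 1,
      Real.arcsin r - Real.arcsin (r * f T) ≤ ∫ t in (0 : ℝ)..T, ρ t := by
    rintro r ⟨hr0, hr1⟩
    obtain ⟨M, hM⟩ := lipschitzOn_arcsin hr1
    have hmaps : ∀ t ∈ Icc 0 T, |r * f t| ≤ r := fun t ht => by
      rw [abs_mul, abs_of_pos hr0]
      exact mul_le_of_le_one_right hr0.le (hf1 t ht)
    have hk : AbsolutelyContinuousOnInterval (fun t => Real.arcsin (r * f t)) 0 T := by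
      have hrf : LipschitzOnWith (‖r‖₊ * K) (fun t => r * f t) (Icc 0 T) := by
        refine LipschitzOnWith.of_dist_le_mul fun x hx y hy => ?_
        have := hf.dist_le_mul x hx y hy
        rw [Real.dist_eq] at this
        rw [Real.dist_eq, ← mul_sub, abs_mul, NNReal.coe_mul, coe_nnnorm, Real.norm_eq_abs,
          mul_assoc]
        gcongr
      have := hM.comp hrf fun t ht => abs_le.1 (hmaps t ht)
      rw [← uIcc_of_le hT] at this
      exact this.absolutelyContinuousOnInterval
    have hle : |∫ t in (0 : ℝ)..T, deriv (fun t => Real.arcsin (r * f t)) t|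
        ≤ ∫ t in (0 : ℝ)..T, ρ t := by
      refine intervalIntegral.norm_integral_le_of_norm_le (E := ℝ) hT ?_ hρ
      have hd' := (ae_restrict_iff' measurableSet_Icc).1 hd
      filter_upwards [hd'] with t hdt ht
      have ht' : t ∈ Icc 0 T := ⟨ht.1.le, ht.2⟩
      obtain ⟨f', hf', hb⟩ := hdt ht'
      have hrt := abs_le.1 (hmaps t ht')
      have hder := (Real.hasDerivAt_arcsin (x := r * f t) (by linarith [hrt.1])
        (by linarith [hrt.2])).comp t (hf'.const_mul r)
      have hder' : deriv (fun t => Real.arcsin (r * f t)) t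
          = 1 / √(1 - (r * f t) ^ 2) * (r * f') := hder.deriv
      have hf2 : f t ^ 2 ≤ 1 := (sq_le_one_iff_abs_le_one _).2 (hf1 t ht')
      have hsq : 0 < 1 - (r * f t) ^ 2 := by nlinarith
      have hpos : 0 < √(1 - (r * f t) ^ 2) := Real.sqrt_pos.2 hsq
      rw [hder', Real.norm_eq_abs, abs_mul, abs_mul, abs_of_pos hr0, abs_of_pos (by positivity),
        one_div, ← div_eq_inv_mul, div_le_iff₀ hpos]
      have hrs : r * √(1 - f t ^ 2) ≤ √(1 - (r * f t) ^ 2) := by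
        refine Real.le_sqrt_of_sq_le ?_
        rw [mul_pow, Real.sq_sqrt (by linarith)]
        nlinarith
      calc r * |f'| ≤ r * (ρ t * √(1 - f t ^ 2)) := by gcongr
        _ = ρ t * (r * √(1 - f t ^ 2)) := by ring
        _ ≤ ρ t * √(1 - (r * f t) ^ 2) := mul_le_mul_of_nonneg_left hrs (hρ0 t)
    rw [hk.integral_deriv_eq_sub, h0, mul_one] at hle
    rw [abs_sub_comm] at hle
    exact (le_abs_self _).trans hle
  have hlim : Tendsto (fun r => Real.arcsin r - Real.arcsin (r * f T)) (𝓝[<] 1)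
      (𝓝 (Real.arcsin 1 - Real.arcsin (1 * f T))) := by
    have hc : Continuous fun r : ℝ => Real.arcsin r - Real.arcsin (r * f T) :=
      Real.continuous_arcsin.sub (Real.continuous_arcsin.comp (by fun_prop))
    exact (hc.tendsto 1).mono_left nhdsWithin_le_nhds
  have := le_of_tendsto hlim (by
    filter_upwards [Ioo_mem_nhdsLT (zero_lt_one' ℝ)] with r hr
    exact key r hr)
  rwa [Real.arcsin_one, one_mul] at this

/-- The entry `(Pᵀ V P) 2 2` is the cosine `f` of the angle between `Y` and `V(t) Y`. Its derivative
is `-a S` times another entry of the same row of a rotation, and that entry is at most `√(1 - f ^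
2)`. -/
theorem IsAdmissible.arccos_le {X Y : EuclideanSpace ℝ (Fin 3)} (hX : ‖X‖ = 1)
    (hY : ‖Y‖ = 1) (hXY : LinearIndependent ℝ ![X, Y]) {P : Matrix (Fin 3) (Fin 3) ℝ} {S ρ : ℝ}
    (hP : IsFrame X Y P S ρ) {g : Matrix.specialOrthogonalGroup (Fin 3) ℝ} {T : ℝ}
    {V : ℝ → Matrix (Fin 3) (Fin 3) ℝ} (h : IsAdmissible X Y g T V) :
    Real.arccos ((Pᵀ * (g : Matrix (Fin 3) (Fin 3) ℝ) * P) 2 2) / S ≤ totalCost 0 X Y T V := by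
  obtain ⟨a, b, htr, hae⟩ := h.exists_isTrajectory hX hY hXY
  have hT := h.nonneg
  have hmem : ∀ t ∈ Icc 0 T, Pᵀ * V t * P ∈ Matrix.specialOrthogonalGroup (Fin 3) ℝ :=
    fun t ht => mul_mem (mul_mem (transpose_mem hP.mem) (h.mem t ht)) hP.mem
  have hlen : ∀ s ∈ Icc 0 T, ∀ t ∈ Icc 0 T, ∫ r in s..t, (|a r| + |b r|) = t - s :=
    integral_eq_sub_of_ae_eq_one (hae.mono fun t ht => ht.2.1)
  -- Entries of `V` have Lipschitz constant `3`, and each of the two multiplications by an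
  -- orthogonal matrix contributes a factor `3`.
  have hLip : LipschitzOnWith 27 (fun t => (Pᵀ * V t * P) 2 2) (Icc 0 T) := by
    refine LipschitzOnWith.of_dist_le_mul fun x hx y hy => ?_
    rw [Real.dist_eq, Real.dist_eq, ← Matrix.sub_apply, ← Matrix.sub_mul, ← Matrix.mul_sub]
    have h1 : ∀ i j, |(V x - V y) i j| ≤ 3 * |x - y| := fun i j => by
      have := htr.abs_sub_le hX hY hy hx i j
      rwa [hlen y hy x hx] at this
    have h2 := abs_mul_apply_le zero_le_one (abs_apply_le_one_of_mem (transpose_mem hP.mem)) h1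
    have h3 := abs_mul_apply_le (by positivity) h2 (abs_apply_le_one_of_mem hP.mem) 2 2
    refine h3.trans (le_of_eq ?_)
    push_cast
    ring
  have hint : IntervalIntegrable (fun t => |a t| * S) volume 0 T :=
    htr.integrable_left.abs.mul_const S
  have := arccos_le_integral hT hLip (fun t ht => abs_apply_le_one_of_mem (hmem t ht) 2 2)
    (by simp [h.init, transpose_mul_self_of_mem hP.mem])
    (fun t => mul_nonneg (abs_nonneg (a t)) hP.pos.le) hint (by
      filter_upwards [hae, ae_restrict_mem measurableSet_Icc] with t ht htm
      refine ⟨_, hasDerivAt_mul_mul_apply ht.2.2 Pᵀ P 2 2, ?_⟩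
      have e : Pᵀ * (V t * gen X Y (a t) (b t)) * P
          = (Pᵀ * V t * P) * (Pᵀ * gen X Y (a t) (b t) * P) := by
        have : Pᵀ * V t * P * (Pᵀ * gen X Y (a t) (b t) * P)
            = Pᵀ * V t * (P * Pᵀ) * gen X Y (a t) (b t) * P := by
          simp only [Matrix.mul_assoc]
        rw [this, mul_transpose_self_of_mem hP.mem, Matrix.mul_one]
        simp only [Matrix.mul_assoc]
      rw [e, hP.transpose_mul_gen_mul, mul_ad_apply_two, abs_neg, abs_mul, abs_mul,
        abs_of_pos hP.pos]
      refine mul_le_mul_of_nonneg_left (Real.abs_le_sqrt ?_)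
        (mul_nonneg (abs_nonneg _) hP.pos.le)
      have hrow := row_inner (hmem t htm) 2 2
      simp only [if_true] at hrow
      nlinarith [mul_self_nonneg ((Pᵀ * V t * P) 2 0)])
  rw [h.final, intervalIntegral.integral_mul_const] at this
  rw [div_le_iff₀ hP.pos, totalCost_eq_integral hXY 0 hT (hae.mono fun t ht => ht.1)]
  simpa using this

end AttitudeControl

theorem proposition3p1 (X Y : EuclideanSpace ℝ (Fin 3)) (hX : ‖X‖ = 1) (hY : ‖Y‖ = 1)
    (hXY : LinearIndependent ℝ ![X, Y]) (κ : ℝ) (hκ0 : 0 ≤ κ) (hκ1 : κ ≤ 1)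
    (g : Matrix.specialOrthogonalGroup (Fin 3) ℝ) :
    ∃ (t₀ : ℝ) (U : ℝ → Matrix (Fin 3) (Fin 3) ℝ), AttitudeControl.IsOptimal κ X Y g t₀ U := by
  obtain ⟨P, S, ρ, hP⟩ := AttitudeControl.exists_isFrame hX hY hXY
  obtain ⟨L, V, hV, hcost⟩ := AttitudeControl.exists_isAdmissible hX hY hXY g hP
  rcases hκ0.eq_or_lt with rfl | hpos
  · exact ⟨L, V, hV, fun s W hW => hcost.trans (hW.arccos_le hX hY hXY hP)⟩
  · exact AttitudeControl.exists_isOptimal_of_pos hX hY hXY hpos hκ1 hV
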